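/- **Setting.** Let $p\ge 2$ asynchronous processes share memory. An execution is an arbitrary interleaving of steps, each with at most one access to shared memory (a read, a write, or a compare-and-swap $\mathrm{CAS}(x,old,new)$, which writes $new$ to $x$ and returns true if $x=old$, and returns false otherwise). A process that is between operations may invoke $\mathrm{Enqueue}(e)$, for any non-null value $e$, or $\mathrm{Dequeue}()$; it then takes the steps of the code below until the operation returns. Processes may stop at any time. Following a null reference, or accessing an array out of bounds, is an error after which the operation never returns. **Data.** There is a fixed binary tree of height $\lceil\log_2 p\rceil$, in which every non-leaf has two children, with exactly one leaf for each process. Each node $v$ has an array $v.blocks[0..\infty]$ of blocks, where initially $v.blocks[0]$ is a block whose integer fields are all $0$ and all other entries are null, and an integer $v.head$, initially $1$. A block has integer fields $sum_{enq},sum_{deq}$, an integer-or-null field $super$ (null when the block is created), and integer fields $end_{left},end_{right}$ (in internal nodes), $element$ (in leaves) and integer $size$ (in the root). All fields but $super$ are immutable. Below, $leaf$ is the leaf of the process that runs the code. **Code.** - $\mathrm{Enqueue}(e)$: $h:=leaf.head$; let $B$ be a new block with $element=e$, $sum_{enq}=leaf.blocks[h-1].sum_{enq}+1$, $sum_{deq}=leaf.blocks[h-1].sum_{deq}$;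 $\mathrm{Append}(B,h)$; return. - $\mathrm{Dequeue}()$: $h:=leaf.head$; let $B$ be a new block with $element=$ null, $sum_{enq}=leaf.blocks[h-1].sum_{enq}$, $sum_{deq}=leaf.blocks[h-1].sum_{deq}+1$; $\mathrm{Append}(B,h)$; $\langle b,i\rangle:=\mathrm{IndexDequeue}(leaf,leaf.head-1,1)$; return $\mathrm{FindResponse}(b,i)$. - $\mathrm{Append}(B,h)$: $leaf.blocks[h]:=B$; $\mathrm{Advance}(leaf,h)$; $\mathrm{Propagate}(leaf.parent)$. - $\mathrm{Propagate}(v)$: if $\mathrm{Refresh}(v)$ returns false, call $\mathrm{Refresh}(v)$ once more; then, if $v\ne root$, $\mathrm{Propagate}(v.parent)$. - $\mathrm{Refresh}(v)$: $h:=v.head$; for $dir=left$ and then $dir=right$: $c:=v.dir.head$ and, if $v.dir.blocks[c]\ne$ null, $\mathrm{Advance}(v.dir,c)$. Then $new:=\mathrm{CreateBlock}(v,h)$. If $new$ is null, return true; else $result:=\mathrm{CAS}(v.blocks[h],\text{null},new)$; $\mathrm{Advance}(v,h)$; return $result$. - $\mathrm{CreateBlock}(v,i)$: make a new block $new$ with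 $end_{left}:=v.left.head-1$; $end_{right}:=v.right.head-1$; for $x\in\{enq,deq\}$, $sum_{x}:=v.left.blocks[end_{left}].sum_x+v.right.blocks[end_{right}].sum_x$ and $num_x:=sum_x-v.blocks[i-1].sum_x$; if $v=root$, $size:=\max(0,v.blocks[i-1].size+num_{enq}-num_{deq})$. Return null if $num_{enq}+num_{deq}=0$, and $new$ otherwise. - $\mathrm{Advance}(v,h)$: if $v\neq root$: $h_p:=v.parent.head$; $\mathrm{CAS}(v.blocks[h].super,\text{null},h_p)$. Then $\mathrm{CAS}(v.head,h,h+1)$. - $\mathrm{IndexDequeue}(v,b,i)$: if $v=root$, return $\langle b,i\rangle$. Otherwise let $v$ be the $dir$-child of $u=v.parent$; $sup:=v.blocks[b].super$; if $b>u.blocks[sup].end_{dir}$, $sup:=sup+1$; add $v.blocks[b-1].sum_{deq}-v.blocks[u.blocks[sup-1].end_{dir}].sum_{deq}$ to $i$; if $dir=right$, also add $u.left.blocks[u.blocks[sup].end_{left}].sum_{deq}-u.left.blocks[u.blocks[sup-1].end_{left}].sum_{deq}$ to $i$; return $\mathrm{IndexDequeue}(u,sup,i)$. - $\mathrm{FindResponse}(b,i)$: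 $num_{enq}:=root.blocks[b].sum_{enq}-root.blocks[b-1].sum_{enq}$. If $root.blocks[b-1].size+num_{enq}<i$, return null. Else $e:=i+root.blocks[b-1].sum_{enq}-root.blocks[b-1].size$; find the least $b_e\le b$ with $root.blocks[b_e].sum_{enq}\ge e$, by a doubling search that compares $e$ with the $sum_{enq}$ fields at indices $b-1,b-2,b-4,b-8,\dots$ (negative indices being replaced by $0$) until one is less than $e$, followed by a binary search between the last two indices; return $\mathrm{GetEnqueue}(root,b_e,e-root.blocks[b_e-1].sum_{enq})$. - $\mathrm{GetEnqueue}(v,b,i)$: if $v$ is a leaf, return $v.blocks[b].element$. Else, for $dir\in\{left,right\}$, let $prev_{dir}:=v.dir.blocks[v.blocks[b-1].end_{dir}].sum_{enq}$, and $sum_{left}:=v.left.blocks[v.blocks[b].end_{left}].sum_{enq}$. If $i\le sum_{left}-prev_{left}$, $dir:=left$; else $dir:=right$ and $i:=i-(sum_{left}-prev_{left})$. Find by binary search the least $b'$ in $[v.blocks[b-1].end_{dir}+1\,..\,v.blocks[b].end_{dir}]$ with $v.dir.blocks[b'].sum_{enq}\ge i+prev_{dir}$; return $\mathrm{GetEnqueue}(v.dir,b',i-(v.dir.blocks[b'-1].sum_{enq}-prev_{dir}))$.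 **Statement.** This queue implementation is wait-free: in every execution, every invoked operation returns after finitely many steps of its own process, provided that this process keeps taking steps, whatever the schedule and whatever the other processes do. -/

import Mathlib

/-! The unbounded-space queue as an asynchronous shared-memory machine: every step of a process
performs at most one access to shared memory, and the steps of the processes are interleaved
arbitrarily. Program variables of type `int` are integers. Dereferencing a null (or
out-of-bounds) array entry is a run-time error, after which the operation never completes. -/

namespace WFQueue

inductive Dir where
  | left
  | right
deriving DecidableEq

/-- A tree node is named by the directions on the path that leads to it from the root, the last
direction first. So `[]` is the root, `d :: v` is the child of `v` in direction `d`, and `v` is the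
parent of `d :: v`. -/
abbrev Node := List Dir

/-- A binary tree of height `⌈log₂ p⌉` with one leaf for each of the `p` processes. Its nodes are the
leaves and their ancestors, that is, the suffixes of the names of the leaves. -/
structure OrderingTree (p : ℕ) where
  /-- the leaf of each process -/
  leaf : Fin p → Node
  /-- leaves of distinct processes are distinct, and no leaf has a proper descendant -/
  leaf_not_suffix : ∀ i j, leaf i <:+ leaf j → i = j
  /-- a proper ancestor of a leaf has both children -/
  full : ∀ i d v, d :: v <:+ leaf i → ∀ d' : Dir, ∃ j, d' :: v <:+ leaf j
  /-- the height is at most `⌈log₂ p⌉` (it cannot be less, as there are `p` leaves) -/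
  height_le : ∀ i, (leaf i).length ≤ Nat.clog 2 p

/-- `v` is a leaf node. -/
def OrderingTree.IsLeaf {p : ℕ} (T : OrderingTree p) (v : Node) : Prop := ∃ i, T.leaf i = v

instance {p : ℕ} (T : OrderingTree p) (v : Node) : Decidable (T.IsLeaf v) :=
  inferInstanceAs (Decidable (∃ i, T.leaf i = v))

/-- Blocks of all nodes have the same record type. `endLeft`, `endRight` are used in internal nodes
only, `element` in leaves only and `size` in the root only. `none` stands for null. -/
structure Block (V : Type*) where
  sumEnq : ℤ := 0
  sumDeq : ℤ := 0
  super : Option ℤ := none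
  endLeft : ℤ := 0
  endRight : ℤ := 0
  element : Option V := none
  size : ℤ := 0

def Block.endDir {V : Type*} (B : Block V) : Dir → ℤ
  | .left => B.endLeft
  | .right => B.endRight

/-- The shared memory. A block sits in exactly one array entry and only its field `super`
changes after it was put there, so that entries hold blocks rather than references to blocks. -/
structure Mem (V : Type*) where
  head : Node → ℤ
  blocks : Node → ℤ → Option (Block V)

/-- Initially every `head` is 1 and every array holds just the empty block at position 0. -/
def Mem.initial (V : Type*) : Mem V where
  head _ := 1
  blocks _ i := if i = 0 then some { super := some 0 } else none

def Mem.setHead {V : Type*} (m : Mem V) (v : Node) (h : ℤ) : Mem V :=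
  { m with head := Function.update m.head v h }

def Mem.setBlock {V : Type*} (m : Mem V) (v : Node) (i : ℤ) (B : Block V) : Mem V :=
  { m with blocks := Function.update m.blocks v (Function.update (m.blocks v) i (some B)) }

inductive Op (V : Type*) where
  | enqueue (e : V)
  | dequeue

/-- `first`, `second`: which of the two calls of `Refresh` in `Propagate` is running. -/
inductive Attempt where
  | first
  | second
deriving DecidableEq

/-- Where a call of `Advance` returns to, with the local variables of the callers. -/
inductive AdvanceCaller where
  /-- `Append` -/
  | append
  /-- `Refresh(v)`, in the iteration of the loop for the child in direction `dir` -/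
  | help (v : Node) (a : Attempt) (h : ℤ) (dir : Dir)
  /-- `Refresh(v)`, at its end -/
  | final (v : Node) (a : Attempt) (result : Bool)

/-- Local state of a process: its program counter with the live local variables. -/
inductive PC (V : Type*) where
  /-- between operations; `response` is what the last operation returned -/
  | idle (response : Option V)
  /-- after a run-time error -/
  | fault
  -- Enqueue, Dequeue, Append
  | opHead (op : Op V)
  | opSumEnq (op : Op V) (h : ℤ)
  | opSumDeq (op : Op V) (h : ℤ) (se : ℤ)
  | appendWrite (op : Op V) (h : ℤ) (B : Block V)
  -- Refresh(v)
  | refreshHead (op : Op V) (v : Node) (a : Attempt)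
  | refreshChildHead (op : Op V) (v : Node) (a : Attempt) (h : ℤ) (dir : Dir)
  | refreshTest (op : Op V) (v : Node) (a : Attempt) (h : ℤ) (dir : Dir) (childHead : ℤ)
  | refreshCas (op : Op V) (v : Node) (a : Attempt) (h : ℤ) (new : Block V)
  -- Advance(v, h)
  | advParentHead (op : Op V) (v : Node) (h : ℤ) (c : AdvanceCaller)
  | advSuper (op : Op V) (v : Node) (h : ℤ) (hp : ℤ) (c : AdvanceCaller)
  | advHead (op : Op V) (v : Node) (h : ℤ) (c : AdvanceCaller)
  -- CreateBlock(v, i)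
  | cbEndLeft (op : Op V) (v : Node) (a : Attempt) (i : ℤ) (new : Block V)
  | cbEndRight (op : Op V) (v : Node) (a : Attempt) (i : ℤ) (new : Block V)
  | cbSumEnqLeft (op : Op V) (v : Node) (a : Attempt) (i : ℤ) (new : Block V)
  | cbSumEnqRight (op : Op V) (v : Node) (a : Attempt) (i : ℤ) (new : Block V)
  | cbSumDeqLeft (op : Op V) (v : Node) (a : Attempt) (i : ℤ) (new : Block V)
  | cbSumDeqRight (op : Op V) (v : Node) (a : Attempt) (i : ℤ) (new : Block V)
  | cbNumEnq (op : Op V) (v : Node) (a : Attempt) (i : ℤ) (new : Block V)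
  | cbNumDeq (op : Op V) (v : Node) (a : Attempt) (i : ℤ) (new : Block V) (numEnq : ℤ)
  | cbSize (op : Op V) (v : Node) (a : Attempt) (i : ℤ) (new : Block V) (numEnq numDeq : ℤ)
  -- IndexDequeue(dir :: u, b, i)
  | deqLeafHead
  | idSuper (u : Node) (dir : Dir) (b i : ℤ)
  | idTest (u : Node) (dir : Dir) (b i sup : ℤ)
  | idPrevSum (u : Node) (dir : Dir) (b i sup : ℤ)
  | idStart (u : Node) (dir : Dir) (i sup : ℤ)
  | idStartSum (u : Node) (dir : Dir) (i sup j : ℤ)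
  | idLeftEnd (u : Node) (i sup : ℤ)
  | idLeftEndSum (u : Node) (i sup j : ℤ)
  | idLeftStart (u : Node) (i sup : ℤ)
  | idLeftStartSum (u : Node) (i sup j : ℤ)
  -- FindResponse(b, i)
  | frSumEnq (b i : ℤ)
  | frPrevSumEnq (b i se : ℤ)
  | frPrevSize (b i numEnq prevEnq : ℤ)
  | frDouble (b e hi d : ℤ)
  | frBinary (e lo hi : ℤ)
  | frRank (e be : ℤ)
  -- GetEnqueue(v, b, i)
  | geElement (v : Node) (b : ℤ)
  | geEndLeft (v : Node) (b i : ℤ)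
  | geSumLeft (v : Node) (b i j : ℤ)
  | gePrevEndLeft (v : Node) (b i sumLeft : ℤ)
  | gePrevLeft (v : Node) (b i sumLeft j : ℤ)
  | gePrevEndRight (v : Node) (b i sumLeft prevLeft : ℤ)
  | gePrevRight (v : Node) (b i sumLeft prevLeft j : ℤ)
  | geLow (v : Node) (b i : ℤ) (dir : Dir) (prev : ℤ)
  | geHigh (v : Node) (b i : ℤ) (dir : Dir) (prev lo : ℤ)
  | geBinary (w : Node) (i prev lo hi : ℤ)
  | geRank (w : Node) (i prev b' : ℤ)

def PC.IsIdle {V : Type*} : PC V → Prop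
  | .idle _ => True
  | _ => False

section Routines

variable {V : Type*} {p : ℕ}

/-- A step that reads `v.blocks[i]` (and a field of that block) and goes on as `k` says. -/
def readBlock (m : Mem V) (v : Node) (i : ℤ) (k : Block V → PC V) : Mem V × PC V :=
  match m.blocks v i with
  | none => (m, .fault)
  | some B => (m, k B)

/-! The control flow between the shared-memory accesses. -/

/-- Begin `Advance(v, h)`. -/
def callAdvance (op : Op V) (v : Node) (h : ℤ) (c : AdvanceCaller) : PC V :=
  if v = [] then .advHead op v h c else .advParentHead op v h c

/-- `Append` returns: an `Enqueue` is complete, a `Dequeue` continues. -/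
def returnAppend : Op V → PC V
  | .enqueue _ => .idle none
  | .dequeue => .deqLeafHead

/-- `Refresh(v)` returns `result` to `Propagate(v)`. -/
def returnRefresh (op : Op V) (v : Node) (a : Attempt) (result : Bool) : PC V :=
  if result = false ∧ a = .first then .refreshHead op v .second
  else match v with
    | [] => returnAppend op
    | _ :: u => .refreshHead op u .first

/-- `Advance` returns to its caller. -/
def returnAdvance (op : Op V) (leaf : Node) : AdvanceCaller → PC V
  | .append => .refreshHead op leaf.tail .first
  | .help v a h .left => .refreshChildHead op v a h .right
  | .help v a h .right => .cbEndLeft op v a h {}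
  | .final v a result => returnRefresh op v a result

/-- The end of `CreateBlock(v, i)`, and what `Refresh(v)` does with the outcome. -/
def returnCreateBlock (op : Op V) (v : Node) (a : Attempt) (i : ℤ) (new : Block V)
    (numEnq numDeq : ℤ) : PC V :=
  if numEnq + numDeq = 0 then returnRefresh op v a true else .refreshCas op v a i new

/-- Begin `IndexDequeue(v, b, i)`; at the root it returns and `FindResponse(b, i)` begins. -/
def callIndexDequeue (v : Node) (b i : ℤ) : PC V :=
  match v with
  | [] => .frSumEnq b i
  | dir :: u => .idSuper u dir b i

/-- Loop head of the binary search in the root. The block sought is in `(lo, hi]`. -/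
def frLoop (e lo hi : ℤ) : PC V :=
  if lo + 1 < hi then .frBinary e lo hi else .frRank e hi

/-- Begin `GetEnqueue(v, b, i)`. -/
def callGetEnqueue (T : OrderingTree p) (v : Node) (b i : ℤ) : PC V :=
  if T.IsLeaf v then .geElement v b else .geEndLeft v b i

/-- Loop head of the binary search in the node `w`. The block sought is in `(lo, hi]`. -/
def geLoop (w : Node) (i prev lo hi : ℤ) : PC V :=
  if lo + 1 < hi then .geBinary w i prev lo hi else .geRank w i prev hi

/-- The block that an operation appends to its leaf, given the sums of the preceding block. -/
def opBlock (se sd : ℤ) : Op V → Block V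
  | .enqueue e => { element := some e, sumEnq := se + 1, sumDeq := sd }
  | .dequeue => { element := none, sumEnq := se, sumDeq := sd + 1 }

/-- One step of the process whose leaf is `leaf`, inside an operation. -/
def exec (T : OrderingTree p) (leaf : Node) (m : Mem V) : PC V → Mem V × PC V
  | .idle r => (m, .idle r)
  | .fault => (m, .fault)
  -- Enqueue, Dequeue: make the block `B`. Append: write it and call `Advance(leaf, h)`.
  | .opHead op => (m, .opSumEnq op (m.head leaf))
  | .opSumEnq op h => readBlock m leaf (h - 1) fun B => .opSumDeq op h B.sumEnq
  | .opSumDeq op h se => readBlock m leaf (h - 1) fun B => .appendWrite op h (opBlock se B.sumDeq op)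
  | .appendWrite op h B => (m.setBlock leaf h B, callAdvance op leaf h .append)
  -- Refresh(v)
  | .refreshHead op v a => (m, .refreshChildHead op v a (m.head v) .left)
  | .refreshChildHead op v a h dir => (m, .refreshTest op v a h dir (m.head (dir :: v)))
  | .refreshTest op v a h dir childHead =>
      if (m.blocks (dir :: v) childHead).isSome then
        (m, callAdvance op (dir :: v) childHead (.help v a h dir))
      else (m, returnAdvance op leaf (.help v a h dir))
  | .refreshCas op v a h new =>
      match m.blocks v h with
      | none => (m.setBlock v h new, callAdvance op v h (.final v a true))
      | some _ => (m, callAdvance op v h (.final v a false))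
  -- Advance(v, h)
  | .advParentHead op v h c => (m, .advSuper op v h (m.head v.tail) c)
  | .advSuper op v h hp c =>
      match m.blocks v h with
      | none => (m, .fault)
      | some B =>
          (if B.super = none then m.setBlock v h { B with super := some hp } else m,
            .advHead op v h c)
  | .advHead op v h c =>
      (if m.head v = h then m.setHead v (h + 1) else m, returnAdvance op leaf c)
  -- CreateBlock(v, i)
  | .cbEndLeft op v a i new =>
      (m, .cbEndRight op v a i { new with endLeft := m.head (.left :: v) - 1 })
  | .cbEndRight op v a i new =>
      (m, .cbSumEnqLeft op v a i { new with endRight := m.head (.right :: v) - 1 })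
  | .cbSumEnqLeft op v a i new => readBlock m (.left :: v) new.endLeft fun B =>
      .cbSumEnqRight op v a i { new with sumEnq := B.sumEnq }
  | .cbSumEnqRight op v a i new => readBlock m (.right :: v) new.endRight fun B =>
      .cbSumDeqLeft op v a i { new with sumEnq := new.sumEnq + B.sumEnq }
  | .cbSumDeqLeft op v a i new => readBlock m (.left :: v) new.endLeft fun B =>
      .cbSumDeqRight op v a i { new with sumDeq := B.sumDeq }
  | .cbSumDeqRight op v a i new => readBlock m (.right :: v) new.endRight fun B =>
      .cbNumEnq op v a i { new with sumDeq := new.sumDeq + B.sumDeq }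
  | .cbNumEnq op v a i new => readBlock m v (i - 1) fun B =>
      .cbNumDeq op v a i new (new.sumEnq - B.sumEnq)
  | .cbNumDeq op v a i new numEnq => readBlock m v (i - 1) fun B =>
      if v = [] then .cbSize op v a i new numEnq (new.sumDeq - B.sumDeq)
      else returnCreateBlock op v a i new numEnq (new.sumDeq - B.sumDeq)
  | .cbSize op v a i new numEnq numDeq => readBlock m v (i - 1) fun B =>
      returnCreateBlock op v a i { new with size := max 0 (B.size + numEnq - numDeq) } numEnq numDeq
  -- Dequeue calls IndexDequeue(leaf, leaf.head - 1, 1).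
  | .deqLeafHead => (m, callIndexDequeue leaf (m.head leaf - 1) 1)
  -- IndexDequeue(dir :: u, b, i)
  | .idSuper u dir b i => readBlock m (dir :: u) b fun B =>
      match B.super with
      | none => .fault
      | some sup => .idTest u dir b i sup
  | .idTest u dir b i sup => readBlock m u sup fun B =>
      .idPrevSum u dir b i (if b > B.endDir dir then sup + 1 else sup)
  | .idPrevSum u dir b i sup => readBlock m (dir :: u) (b - 1) fun B =>
      .idStart u dir (i + B.sumDeq) sup
  | .idStart u dir i sup => readBlock m u (sup - 1) fun B =>
      .idStartSum u dir i sup (B.endDir dir)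
  | .idStartSum u dir i sup j => readBlock m (dir :: u) j fun B =>
      match dir with
      | .left => callIndexDequeue u sup (i - B.sumDeq)
      | .right => .idLeftEnd u (i - B.sumDeq) sup
  | .idLeftEnd u i sup => readBlock m u sup fun B => .idLeftEndSum u i sup B.endLeft
  | .idLeftEndSum u i sup j => readBlock m (.left :: u) j fun B =>
      .idLeftStart u (i + B.sumDeq) sup
  | .idLeftStart u i sup => readBlock m u (sup - 1) fun B => .idLeftStartSum u i sup B.endLeft
  | .idLeftStartSum u i sup j => readBlock m (.left :: u) j fun B =>
      callIndexDequeue u sup (i - B.sumDeq)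
  -- FindResponse(b, i): a doubling search for the left end, then a binary search
  | .frSumEnq b i => readBlock m [] b fun B => .frPrevSumEnq b i B.sumEnq
  | .frPrevSumEnq b i se => readBlock m [] (b - 1) fun B =>
      .frPrevSize b i (se - B.sumEnq) B.sumEnq
  | .frPrevSize b i numEnq prevEnq => readBlock m [] (b - 1) fun B =>
      if B.size + numEnq < i then .idle none
      else .frDouble b (i + prevEnq - B.size) b 1
  | .frDouble b e hi d => readBlock m [] (max 0 (b - d)) fun B =>
      if B.sumEnq < e then frLoop e (max 0 (b - d)) hi
      else .frDouble b e (max 0 (b - d)) (2 * d)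
  | .frBinary e lo hi => readBlock m [] ((lo + hi) / 2) fun B =>
      if B.sumEnq ≥ e then frLoop e lo ((lo + hi) / 2) else frLoop e ((lo + hi) / 2) hi
  | .frRank e be => readBlock m [] (be - 1) fun B => callGetEnqueue T [] be (e - B.sumEnq)
  -- GetEnqueue(v, b, i)
  | .geElement v b => readBlock m v b fun B => .idle B.element
  | .geEndLeft v b i => readBlock m v b fun B => .geSumLeft v b i B.endLeft
  | .geSumLeft v b i j => readBlock m (.left :: v) j fun B => .gePrevEndLeft v b i B.sumEnq
  | .gePrevEndLeft v b i sumLeft => readBlock m v (b - 1) fun B =>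
      .gePrevLeft v b i sumLeft B.endLeft
  | .gePrevLeft v b i sumLeft j => readBlock m (.left :: v) j fun B =>
      .gePrevEndRight v b i sumLeft B.sumEnq
  | .gePrevEndRight v b i sumLeft prevLeft => readBlock m v (b - 1) fun B =>
      .gePrevRight v b i sumLeft prevLeft B.endRight
  | .gePrevRight v b i sumLeft prevLeft j => readBlock m (.right :: v) j fun B =>
      if i ≤ sumLeft - prevLeft then .geLow v b i .left prevLeft
      else .geLow v b (i - (sumLeft - prevLeft)) .right B.sumEnq
  | .geLow v b i dir prev => readBlock m v (b - 1) fun B => .geHigh v b i dir prev (B.endDir dir)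
  | .geHigh v b i dir prev lo => readBlock m v b fun B =>
      geLoop (dir :: v) i prev lo (B.endDir dir)
  | .geBinary w i prev lo hi => readBlock m w ((lo + hi) / 2) fun B =>
      if B.sumEnq ≥ i + prev then geLoop w i prev lo ((lo + hi) / 2)
      else geLoop w i prev ((lo + hi) / 2) hi
  | .geRank w i prev b' => readBlock m w (b' - 1) fun B =>
      callGetEnqueue T w b' (i - (B.sumEnq - prev))

end Routines

/-- A configuration: the shared memory and the local state of every process. -/
structure Config (V : Type*) (p : ℕ) where
  mem : Mem V
  pc : Fin p → PC V

def Config.initial (V : Type*) (p : ℕ) : Config V p where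
  mem := Mem.initial V
  pc _ := .idle none

/-- `C'` results from `C` by a step of process `i`: the invocation of an arbitrary operation if `i`
is between operations, and otherwise the next step of its pending operation. -/
inductive Step {V : Type*} {p : ℕ} (T : OrderingTree p) (i : Fin p) (C : Config V p) :
    Config V p → Prop where
  | invoke (op : Op V) (h : (C.pc i).IsIdle) :
      Step T i C { C with pc := Function.update C.pc i (.opHead op) }
  | advance (h : ¬ (C.pc i).IsIdle) :
      Step T i C
        { mem := (exec T (T.leaf i) C.mem (C.pc i)).1
          pc := Function.update C.pc i (exec T (T.leaf i) C.mem (C.pc i)).2 }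

/-- An infinite execution, under an arbitrary schedule. -/
structure Execution (V : Type*) {p : ℕ} (T : OrderingTree p) where
  config : ℕ → Config V p
  /-- the process that takes the `t`-th step -/
  sched : ℕ → Fin p
  start : config 0 = Config.initial V p
  step : ∀ t, Step T (sched t) (config t) (config (t + 1))

/-- In every execution, an operation of process `i` that is pending at time `t` completes if `i`
keeps taking steps, whatever the other processes do (they may also stop for ever). -/
def WaitFree (V : Type*) {p : ℕ} (T : OrderingTree p) : Prop :=
  ∀ (E : Execution V T) (i : Fin p) (t : ℕ), ¬ ((E.config t).pc i).IsIdle →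
    (∀ n, ∃ k ≥ n, E.sched k = i) → ∃ t' ≥ t, ((E.config t').pc i).IsIdle

end WFQueue

/-!
A process can fail to finish an operation in two ways only: it follows a null reference, or it runs
through a loop for ever. Both are excluded by an invariant of the reachable configurations.

*Propagation.* A ghost variable `G u d s` records how far the array of the `d`-child of `u` was
filled when `u.head` moved from `s` to `s + 1`. Whoever installs block `s + 1` of `u` has first read
`u.head = s + 1` and then helped both children to advance, so that block ends at `G u d s` or later
(`Inv.ghost_le`). This fact serves twice. First, if both attempts of `Refresh` in `Propagate` fail,
the block that beat the second attempt contains everything that was there before the first attempt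
read `head`; hence after `Propagate` the block of the operation is contained in a block of every
ancestor of the leaf (`localInv_returnAdvance`, `Reach`). Secondly, the field `super` of a block was
read from the parent's `head` when the block was already installed, and it was written before the
block could enter a block of the parent; so `super` is the index of the superblock or one less
(`Inv.endDir_super_lt`, `Inv.super_marker`, `stepOK_idTest`). A `Refresh` that finds nothing to do
is harmless, because `sumEnq + sumDeq` is strictly increasing along every array, so that the ends of
its candidate are those of the block already there (`Candidate.endDir_eq`).

*Searches.* `IndexDequeue` keeps its rank at least `1`, and `size ≤ sumEnq` at the root. So the
doubling search looks for a number `e ≥ 1` and stops at block `0` at the latest. When `FindResponse`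
does not return null, `e` is at most the `sumEnq` of the block it starts from, so every later search
has a nonempty range, and `GetEnqueue` reaches a leaf.

The invariant has a global part `Inv` and a part `LocalInv` for every local state. The local part is
stable under any growth of the memory that leaves the array of the own leaf alone
(`LocalInv.mono`), so only the process that takes a step has to be considered (`stepOK_exec`).
Under the invariant, each step of a process either ends its operation or decreases its local state
in a lexicographic order that does not depend on the memory (`exec_below`). The steps of other
processes leave that local state unchanged.
-/

namespace WFQueue

variable {V : Type*} {p : ℕ}

/-! ### Reading the shared memory -/

/-- The entry `v.blocks[i]` is not null. -/
def Mem.Has (m : Mem V) (v : Node) (i : ℤ) : Prop := (m.blocks v i).isSome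

/-- The block `v.blocks[i]`; the empty block if that entry is null. -/
def Mem.block (m : Mem V) (v : Node) (i : ℤ) : Block V := (m.blocks v i).getD {}

theorem Mem.Has.blocks_eq {m : Mem V} {v : Node} {i : ℤ} (h : m.Has v i) :
    m.blocks v i = some (m.block v i) := by
  obtain ⟨B, hB⟩ := Option.isSome_iff_exists.1 h
  simp [Mem.block, hB]

theorem Mem.blocks_eq_none {m : Mem V} {v : Node} {i : ℤ} (h : ¬ m.Has v i) :
    m.blocks v i = none := by
  simpa [Mem.Has] using h

theorem readBlock_eq {m : Mem V} {v : Node} {i : ℤ} (h : m.Has v i) (k : Block V → PC V) :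
    readBlock m v i k = (m, k (m.block v i)) := by
  simp [readBlock, h.blocks_eq]

theorem Mem.has_of_super {m : Mem V} {v : Node} {i s : ℤ} (h : (m.block v i).super = some s) :
    m.Has v i := by
  by_contra hn
  simp [Mem.block, Mem.blocks_eq_none hn] at h

theorem Mem.has_setBlock {m : Mem V} {v : Node} {i : ℤ} {B : Block V} {w : Node} {j : ℤ} :
    (m.setBlock v i B).Has w j ↔ (w = v ∧ j = i) ∨ m.Has w j := by
  by_cases hw : w = v
  · subst hw
    by_cases hj : j = i <;> simp [Mem.Has, Mem.setBlock, hj]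
  · simp [Mem.Has, Mem.setBlock, hw]

theorem Mem.block_setBlock_self (m : Mem V) (v : Node) (i : ℤ) (B : Block V) :
    (m.setBlock v i B).block v i = B := by
  simp [Mem.block, Mem.setBlock]

theorem Mem.block_setBlock_of_ne (m : Mem V) {v : Node} {i : ℤ} (B : Block V) {w : Node} {j : ℤ}
    (h : ¬ (w = v ∧ j = i)) : (m.setBlock v i B).block w j = m.block w j := by
  by_cases hw : w = v
  · subst hw
    simp [Mem.block, Mem.setBlock, show j ≠ i from fun e => h ⟨rfl, e⟩]
  · simp [Mem.block, Mem.setBlock, hw]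

/-! ### Growth of the shared memory -/

/-- `m'` is a possible later state of the memory `m`: heads have only grown, blocks have only been
added, and `super` fields have only changed from null to an integer. The other fields of a block are
constant as well; only those that the local invariants mention are listed. -/
structure Mem.Le (m m' : Mem V) : Prop where
  head : ∀ v, m.head v ≤ m'.head v
  has : ∀ {v i}, m.Has v i → m'.Has v i
  sumEnq : ∀ {v i}, m.Has v i → (m'.block v i).sumEnq = (m.block v i).sumEnq
  sumDeq : ∀ {v i}, m.Has v i → (m'.block v i).sumDeq = (m.block v i).sumDeq
  endDir : ∀ {v i} d, m.Has v i → (m'.block v i).endDir d = (m.block v i).endDir d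
  super : ∀ {v i s}, (m.block v i).super = some s → (m'.block v i).super = some s

theorem Mem.Le.refl (m : Mem V) : m.Le m :=
  ⟨fun _ => le_rfl, id, fun _ => rfl, fun _ => rfl, fun _ _ => rfl, id⟩

theorem Mem.Le.trans {m₁ m₂ m₃ : Mem V} (h : m₁.Le m₂) (h' : m₂.Le m₃) : m₁.Le m₃ where
  head v := (h.head v).trans (h'.head v)
  has hh := h'.has (h.has hh)
  sumEnq hh := (h'.sumEnq (h.has hh)).trans (h.sumEnq hh)
  sumDeq hh := (h'.sumDeq (h.has hh)).trans (h.sumDeq hh)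
  endDir d hh := (h'.endDir d (h.has hh)).trans (h.endDir d hh)
  super hh := h'.super (h.super hh)

/-- A ghost variable: `G u d s` is the highest index of a block that the `d`-child of `u` held
when `u.head` was increased from `s` to `s + 1`. It has no meaning for `s ≥ u.head`. -/
abbrev Ghost := Node → Dir → ℤ → ℤ

/-- Growth of the memory together with the ghost variable. -/
structure Ext (m : Mem V) (G : Ghost) (m' : Mem V) (G' : Ghost) : Prop extends m.Le m' where
  frozen : ∀ u d s, s < m.head u → G' u d s = G u d s
  passed : ∀ u d s b, m.head u ≤ s → s < m'.head u → m.Has (d :: u) b → b ≤ G' u d s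

theorem Mem.Le.ext {m m' : Mem V} (G : Ghost) (h : m.Le m') (hh : m'.head = m.head) :
    Ext m G m' G where
  toLe := h
  frozen _ _ _ _ := rfl
  passed u d s b h₁ h₂ := by rw [hh] at h₂; omega

/-- The block `b` of the `d`-child of `u` was there at a time when `u.head` was at most `s`. -/
def Marker (m : Mem V) (G : Ghost) (u : Node) (d : Dir) (b s : ℤ) : Prop :=
  m.Has (d :: u) b ∧ (s < m.head u → b ≤ G u d s)

theorem Marker.mono {m m' : Mem V} {G G' : Ghost} (e : Ext m G m' G') {u : Node} {d : Dir}
    {b s : ℤ} (h : Marker m G u d b s) : Marker m' G' u d b s := by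
  refine ⟨e.has h.1, fun hs => ?_⟩
  by_cases hs' : s < m.head u
  · rw [e.frozen u d s hs']
    exact h.2 hs'
  · exact e.passed u d s b (not_lt.1 hs') hs h.1

theorem marker_head {m : Mem V} {G : Ghost} {u : Node} {d : Dir} {b : ℤ} (h : m.Has (d :: u) b) :
    Marker m G u d b (m.head u) := ⟨h, fun h => absurd h (lt_irrefl _)⟩

/-! ### The invariant of the shared memory -/

/-- The global invariant, about the memory and the ghost variable. -/
structure Inv (T : OrderingTree p) (m : Mem V) (G : Ghost) : Prop where
  head_pos : ∀ v, 1 ≤ m.head v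
  zero_sumEnq : ∀ v, (m.block v 0).sumEnq = 0
  zero_endDir : ∀ v d, (m.block v 0).endDir d = 0
  nonneg : ∀ {v i}, m.Has v i → 0 ≤ i
  filled : ∀ {v i}, 0 ≤ i → i < m.head v → m.Has v i
  le_head : ∀ {v i}, m.Has v i → i ≤ m.head v
  endDir_nonneg : ∀ {v i}, ¬ T.IsLeaf v → m.Has v i → ∀ d, 0 ≤ (m.block v i).endDir d
  endDir_lt : ∀ {v i}, ¬ T.IsLeaf v → m.Has v i → ∀ d, (m.block v i).endDir d < m.head (d :: v)
  sumEnq_eq : ∀ {v i}, ¬ T.IsLeaf v → m.Has v i → (m.block v i).sumEnq =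
    (m.block (.left :: v) ((m.block v i).endDir .left)).sumEnq +
      (m.block (.right :: v) ((m.block v i).endDir .right)).sumEnq
  sumDeq_eq : ∀ {v i}, ¬ T.IsLeaf v → m.Has v i → (m.block v i).sumDeq =
    (m.block (.left :: v) ((m.block v i).endDir .left)).sumDeq +
      (m.block (.right :: v) ((m.block v i).endDir .right)).sumDeq
  sumEnq_le : ∀ {v i}, 0 ≤ i → m.Has v (i + 1) →
    (m.block v i).sumEnq ≤ (m.block v (i + 1)).sumEnq
  sumDeq_le : ∀ {v i}, 0 ≤ i → m.Has v (i + 1) →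
    (m.block v i).sumDeq ≤ (m.block v (i + 1)).sumDeq
  sum_lt : ∀ {v i}, 0 ≤ i → m.Has v (i + 1) → (m.block v i).sumEnq + (m.block v i).sumDeq <
    (m.block v (i + 1)).sumEnq + (m.block v (i + 1)).sumDeq
  endDir_le : ∀ {v i}, ¬ T.IsLeaf v → 0 ≤ i → m.Has v (i + 1) → ∀ d,
    (m.block v i).endDir d ≤ (m.block v (i + 1)).endDir d
  size_le : ∀ {i}, m.Has [] i → (m.block [] i).size ≤ (m.block [] i).sumEnq
  super_isSome : ∀ {d u i}, 0 ≤ i → i < m.head (d :: u) → (m.block (d :: u) i).super.isSome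
  super_pos : ∀ {d u b s}, 1 ≤ b → (m.block (d :: u) b).super = some s → 1 ≤ s
  super_le : ∀ {d u b s}, 1 ≤ b → (m.block (d :: u) b).super = some s → s ≤ m.head u
  /-- The blocks of `u` before index `super` do not contain the block `b` of the child. -/
  endDir_super_lt : ∀ {d u b s}, ¬ T.IsLeaf u → 1 ≤ b → (m.block (d :: u) b).super = some s →
    (m.block u (s - 1)).endDir d < b
  super_marker : ∀ {d u b s}, 1 ≤ b → (m.block (d :: u) b).super = some s → Marker m G u d b s
  ghost_has : ∀ u d s, m.Has (d :: u) (G u d s)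
  /-- Whoever installs block `s + 1` of `u` has read `u.head = s + 1` before it helped the children,
  so that block contains everything the children held when `u.head` became `s + 1`. -/
  ghost_le : ∀ {u d s}, ¬ T.IsLeaf u → 0 ≤ s → m.Has u (s + 1) →
    G u d s ≤ (m.block u (s + 1)).endDir d

section Consequences

variable {T : OrderingTree p} {m : Mem V} {G : Ghost} (I : Inv T m G)
include I

theorem Inv.has_of_le {v : Node} {i j : ℤ} (hi : 0 ≤ i) (hij : i ≤ j) (hj : m.Has v j) :
    m.Has v i := by
  rcases hij.eq_or_lt with rfl | h
  · exact hj
  · exact I.filled hi (h.trans_le (I.le_head hj))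

theorem Inv.has_zero (v : Node) : m.Has v 0 := I.filled le_rfl (by have := I.head_pos v; omega)

theorem Inv.sumEnq_mono {v : Node} {i j : ℤ} (hi : 0 ≤ i) (hij : i ≤ j) (hj : m.Has v j) :
    (m.block v i).sumEnq ≤ (m.block v j).sumEnq := by
  induction j, hij using Int.leInduction with
  | base => exact le_rfl
  | succ j hij ih =>
    exact (ih (I.has_of_le (by omega) (by omega) hj)).trans (I.sumEnq_le (by omega) hj)

theorem Inv.sumDeq_mono {v : Node} {i j : ℤ} (hi : 0 ≤ i) (hij : i ≤ j) (hj : m.Has v j) :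
    (m.block v i).sumDeq ≤ (m.block v j).sumDeq := by
  induction j, hij using Int.leInduction with
  | base => exact le_rfl
  | succ j hij ih =>
    exact (ih (I.has_of_le (by omega) (by omega) hj)).trans (I.sumDeq_le (by omega) hj)

theorem Inv.endDir_mono {v : Node} (hv : ¬ T.IsLeaf v) {i j : ℤ} (hi : 0 ≤ i) (hij : i ≤ j)
    (hj : m.Has v j) (d : Dir) : (m.block v i).endDir d ≤ (m.block v j).endDir d := by
  induction j, hij using Int.leInduction with
  | base => exact le_rfl
  | succ j hij ih =>
    exact (ih (I.has_of_le (by omega) (by omega) hj)).trans (I.endDir_le hv (by omega) hj d)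

theorem Inv.sum_strictMono {v : Node} {i j : ℤ} (hi : 0 ≤ i) (hij : i < j) (hj : m.Has v j) :
    (m.block v i).sumEnq + (m.block v i).sumDeq < (m.block v j).sumEnq + (m.block v j).sumDeq := by
  have h1 := I.sum_lt hi (I.has_of_le (by omega) (by omega : i + 1 ≤ j) hj)
  have h2 := I.sumEnq_mono (by omega) (by omega : i + 1 ≤ j) hj
  have h3 := I.sumDeq_mono (by omega) (by omega : i + 1 ≤ j) hj
  omega

theorem Inv.sumEnq_nonneg {v : Node} {i : ℤ} (h : m.Has v i) : 0 ≤ (m.block v i).sumEnq := by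
  have := I.sumEnq_mono le_rfl (I.nonneg h) h
  rwa [I.zero_sumEnq] at this

theorem Inv.has_endDir {v : Node} {i : ℤ} (hv : ¬ T.IsLeaf v) (h : m.Has v i) (d : Dir) :
    m.Has (d :: v) ((m.block v i).endDir d) :=
  I.filled (I.endDir_nonneg hv h d) (I.endDir_lt hv h d)

/-- A sum grows between two blocks only if the range of child blocks is not empty. -/
theorem Inv.lt_of_sumEnq_lt {v : Node} {i j : ℤ} (hi : m.Has v i) (hj : 0 ≤ j)
    (h : (m.block v i).sumEnq < (m.block v j).sumEnq) : i < j := by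
  by_contra hn
  have := I.sumEnq_mono hj (not_lt.1 hn) hi
  omega

end Consequences

theorem inv_initial (T : OrderingTree p) : Inv T (Mem.initial V) (fun _ _ _ => 0) := by
  have hh : ∀ {v i}, (Mem.initial V).Has v i ↔ i = 0 := by
    intro v i
    by_cases h : i = 0 <;> simp [Mem.Has, Mem.initial, h]
  have hb : ∀ v, (Mem.initial V).block v 0 = { super := some 0 } := by
    intro v
    simp [Mem.block, Mem.initial]
  have hs : ∀ {v i s}, 1 ≤ i → ((Mem.initial V).block v i).super = some s → False := by
    intro v i s hi h
    have := hh.1 (Mem.has_of_super h)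
    omega
  have he : ∀ d, ({ super := some 0 } : Block V).endDir d = 0 := by rintro (_ | _) <;> rfl
  constructor
  case super_pos => exact fun h₁ h₂ => (hs h₁ h₂).elim
  case super_le => exact fun h₁ h₂ => (hs h₁ h₂).elim
  case endDir_super_lt => exact fun _ h₁ h₂ => (hs h₁ h₂).elim
  case super_marker => exact fun h₁ h₂ => (hs h₁ h₂).elim
  case head_pos => exact fun _ => le_rfl
  case super_isSome =>
    intro d u i h₁ h₂
    have : i < 1 := h₂
    obtain rfl : i = 0 := by omega
    simp [hb]
  case filled =>
    intro v i h₁ h₂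
    have : i < 1 := h₂
    exact hh.2 (by omega)
  case le_head =>
    intro v i h
    have := hh.1 h
    change i ≤ 1
    omega
  case endDir_lt =>
    intro v i _ h d
    obtain rfl := hh.1 h
    rw [hb, he]
    exact one_pos
  all_goals intros
  all_goals first
    | (simp_all; done)
    | (have := hh.1 ‹_›; omega)

/-! ### The writes to the shared memory -/

section Writes

variable {T : OrderingTree p} {m : Mem V} {G : Ghost} (I : Inv T m G)
include I

open Classical in
/-- Incrementing `v.head` past an installed block whose field `super` is set. -/
theorem Inv.setHead {v : Node} {h : ℤ} (hh : m.head v = h) (hb : m.Has v h)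
    (hs : v ≠ [] → (m.block v h).super.isSome) :
    ∃ G', Inv T (m.setHead v (h + 1)) G' ∧ Ext m G (m.setHead v (h + 1)) G' := by
  subst hh
  have hhead : ∀ w, (m.setHead v (m.head v + 1)).head w =
      if w = v then m.head v + 1 else m.head w := by
    intro w
    by_cases hw : w = v
    · subst hw; simp [Mem.setHead]
    · simp [Mem.setHead, hw]
  have hmono : ∀ w, m.head w ≤ (m.setHead v (m.head v + 1)).head w := by
    intro w
    rw [hhead]
    split_ifs with hw
    · rw [hw]; omega
    · exact le_rfl
  -- the highest index of a block in the `d`-child of `v`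
  let top : Dir → ℤ := fun d =>
    if m.Has (d :: v) (m.head (d :: v)) then m.head (d :: v) else m.head (d :: v) - 1
  have htop : ∀ d, m.Has (d :: v) (top d) := by
    intro d
    by_cases h : m.Has (d :: v) (m.head (d :: v))
    · simpa only [top, if_pos h] using h
    · simp only [top, if_neg h]
      exact I.filled (by have := I.head_pos (d :: v); omega) (by omega)
  have hle_top : ∀ d b, m.Has (d :: v) b → b ≤ top d := by
    intro d b hb'
    have := I.le_head hb'
    by_cases h : m.Has (d :: v) (m.head (d :: v))
    · simpa only [top, if_pos h] using this
    · simp only [top, if_neg h]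
      rcases this.eq_or_lt with h' | h'
      · exact absurd (h' ▸ hb') h
      · omega
  let G' : Ghost := fun u d s => if u = v ∧ s = m.head v then top d else G u d s
  have E : Ext m G (m.setHead v (m.head v + 1)) G' := by
    refine ⟨⟨hmono, id, fun _ => rfl, fun _ => rfl, fun _ _ => rfl, id⟩, ?_, ?_⟩
    · intro u d s hs
      have : ¬ (u = v ∧ s = m.head v) := by
        rintro ⟨rfl, rfl⟩
        exact lt_irrefl _ hs
      simp [G', this]
    · intro u d s b h1 h2 h3
      rw [hhead] at h2
      split_ifs at h2 with hu
      · subst hu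
        have : s = m.head u := by omega
        simp only [G', this, and_self, if_true]
        exact hle_top d b h3
      · omega
  refine ⟨G', ?_, E⟩
  exact
    { head_pos := fun w => (I.head_pos w).trans (hmono w)
      zero_sumEnq := I.zero_sumEnq
      zero_endDir := I.zero_endDir
      nonneg := I.nonneg
      filled := by
        intro w i h0 hi
        rw [hhead] at hi
        split_ifs at hi with hw
        · subst hw
          rcases (show i ≤ m.head w by omega).eq_or_lt with rfl | hi'
          · exact hb
          · exact I.filled h0 hi'
        · exact I.filled h0 hi
      le_head := fun h => (I.le_head h).trans (hmono _)
      endDir_nonneg := I.endDir_nonneg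
      endDir_lt := fun hv h d => (I.endDir_lt hv h d).trans_le (hmono _)
      sumEnq_eq := I.sumEnq_eq
      sumDeq_eq := I.sumDeq_eq
      sumEnq_le := I.sumEnq_le
      sumDeq_le := I.sumDeq_le
      sum_lt := I.sum_lt
      endDir_le := I.endDir_le
      size_le := I.size_le
      super_isSome := by
        intro d u i h0 hi
        rw [hhead] at hi
        split_ifs at hi with hw
        · rcases (show i ≤ m.head v by omega).eq_or_lt with rfl | hi'
          · subst hw
            exact hs (by simp)
          · exact I.super_isSome h0 (hw ▸ hi')
        · exact I.super_isSome h0 hi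
      super_pos := I.super_pos
      super_le := fun h1 h2 => (I.super_le h1 h2).trans (hmono _)
      endDir_super_lt := I.endDir_super_lt
      super_marker := fun h1 h2 => (I.super_marker h1 h2).mono E
      ghost_has := by
        intro u d s
        change m.Has (d :: u) (G' u d s)
        by_cases h : u = v ∧ s = m.head v
        · obtain ⟨rfl, rfl⟩ := h
          simpa [G'] using htop d
        · simpa [G', h] using I.ghost_has u d s
      ghost_le := by
        intro u d s hu h0 h1
        change m.Has u (s + 1) at h1
        change G' u d s ≤ (m.block u (s + 1)).endDir d
        have : ¬ (u = v ∧ s = m.head v) := by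
          rintro ⟨rfl, rfl⟩
          have := I.le_head h1
          omega
        simpa [G', this] using I.ghost_le hu h0 h1 }

/-- Setting the field `super` of a block to a value of the parent's `head` that was read when the
block was already installed. As `super` was null, `head` has not yet passed the block, so no block
of the parent contains it. -/
theorem Inv.setSuper {d : Dir} {u : Node} {b s : ℤ} (hb : m.Has (d :: u) b)
    (hn : (m.block (d :: u) b).super = none) (hs1 : 1 ≤ s) (hs : s ≤ m.head u)
    (hM : Marker m G u d b s) :
    Inv T (m.setBlock (d :: u) b { m.block (d :: u) b with super := some s }) G ∧
      Ext m G (m.setBlock (d :: u) b { m.block (d :: u) b with super := some s }) G ∧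
      ∀ w j, (m.setBlock (d :: u) b { m.block (d :: u) b with super := some s }).Has w j ↔
        m.Has w j := by
  set m' := m.setBlock (d :: u) b { m.block (d :: u) b with super := some s } with hm'
  have hhas : ∀ w j, m'.Has w j ↔ m.Has w j := by
    intro w j
    rw [hm', Mem.has_setBlock]
    constructor
    · rintro (⟨rfl, rfl⟩ | h)
      · exact hb
      · exact h
    · exact Or.inr
  have hcases : ∀ w j, (w = d :: u ∧ j = b ∧
      m'.block w j = { m.block w j with super := some s }) ∨
      (¬ (w = d :: u ∧ j = b) ∧ m'.block w j = m.block w j) := by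
    intro w j
    by_cases h : w = d :: u ∧ j = b
    · obtain ⟨rfl, rfl⟩ := h
      exact Or.inl ⟨rfl, rfl, Mem.block_setBlock_self ..⟩
    · exact Or.inr ⟨h, Mem.block_setBlock_of_ne _ _ h⟩
  have hE : ∀ w j, (m'.block w j).sumEnq = (m.block w j).sumEnq := by
    intro w j
    rcases hcases w j with ⟨_, _, h⟩ | ⟨_, h⟩ <;> rw [h]
  have hD : ∀ w j, (m'.block w j).sumDeq = (m.block w j).sumDeq := by
    intro w j
    rcases hcases w j with ⟨_, _, h⟩ | ⟨_, h⟩ <;> rw [h]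
  have hS : ∀ w j, (m'.block w j).size = (m.block w j).size := by
    intro w j
    rcases hcases w j with ⟨_, _, h⟩ | ⟨_, h⟩ <;> rw [h]
  have hd : ∀ w j d, (m'.block w j).endDir d = (m.block w j).endDir d := by
    intro w j d
    rcases hcases w j with ⟨_, _, h⟩ | ⟨_, h⟩ <;> rw [h]
    cases d <;> rfl
  have hsup : ∀ {w j t}, (m'.block w j).super = some t →
      (w = d :: u ∧ j = b ∧ t = s) ∨ (m.block w j).super = some t := by
    intro w j t ht
    rcases hcases w j with ⟨hw, hj, h⟩ | ⟨_, h⟩ <;> rw [h] at ht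
    · exact Or.inl ⟨hw, hj, (Option.some.inj ht).symm⟩
    · exact Or.inr ht
  have hsup' : ∀ {w j t}, (m.block w j).super = some t → (m'.block w j).super = some t := by
    intro w j t ht
    rcases hcases w j with ⟨rfl, rfl, h⟩ | ⟨_, h⟩
    · rw [hn] at ht
      cases ht
    · rw [h, ht]
  have hhead : m'.head = m.head := rfl
  have E : Ext m G m' G := Mem.Le.ext G
    ⟨fun _ => le_rfl, (hhas _ _).2, fun _ => hE _ _, fun _ => hD _ _, fun _ _ => hd _ _ _, hsup'⟩
    hhead
  refine ⟨?_, E, hhas⟩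
  -- `head` passes a block only when its `super` is set, and the parent's blocks end before `head`
  have hpast : m.head (d :: u) ≤ b := by
    by_contra hlt
    have := I.super_isSome (I.nonneg hb) (not_le.1 hlt)
    rw [hn] at this
    cases this
  constructor
  case super_pos =>
    intro d' u' b' s' h1 h2
    rcases hsup h2 with ⟨h, rfl, rfl⟩ | h
    · exact hs1
    · exact I.super_pos h1 h
  case super_le =>
    intro d' u' b' s' h1 h2
    rw [hhead]
    rcases hsup h2 with ⟨h, rfl, rfl⟩ | h
    · cases h
      exact hs
    · exact I.super_le h1 h
  case endDir_super_lt =>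
    intro d' u' b' s' hu h1 h2
    rw [hd]
    rcases hsup h2 with ⟨h, rfl, rfl⟩ | h
    · cases h
      exact (I.endDir_lt hu (I.filled (by omega) (by omega)) _).trans_le hpast
    · exact I.endDir_super_lt hu h1 h
  case super_marker =>
    intro d' u' b' s' h1 h2
    rcases hsup h2 with ⟨h, rfl, rfl⟩ | h
    · cases h
      exact hM.mono E
    · exact (I.super_marker h1 h).mono E
  case super_isSome =>
    intro d' u' i h0 hi
    obtain ⟨t, ht⟩ := Option.isSome_iff_exists.1 (I.super_isSome h0 hi)
    rw [hsup' ht]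
    rfl
  all_goals simp only [hhas, hE, hD, hS, hd, hhead]
  · exact I.head_pos
  · exact I.zero_sumEnq
  · exact I.zero_endDir
  · exact I.nonneg
  · exact I.filled
  · exact I.le_head
  · exact I.endDir_nonneg
  · exact I.endDir_lt
  · exact I.sumEnq_eq
  · exact I.sumDeq_eq
  · exact I.sumEnq_le
  · exact I.sumDeq_le
  · exact I.sum_lt
  · exact I.endDir_le
  · exact I.size_le
  · exact I.ghost_has
  · exact I.ghost_le

/-- Installing a new block at the position `v.head`. -/
theorem Inv.addBlock {v : Node} {h : ℤ} {B : Block V} (hh : h = m.head v) (hn : ¬ m.Has v h)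
    (hsuper : B.super = none)
    (hE : (m.block v (h - 1)).sumEnq ≤ B.sumEnq) (hD : (m.block v (h - 1)).sumDeq ≤ B.sumDeq)
    (hED : (m.block v (h - 1)).sumEnq + (m.block v (h - 1)).sumDeq < B.sumEnq + B.sumDeq)
    (hend : ¬ T.IsLeaf v → ∀ d, G v d (h - 1) ≤ B.endDir d ∧
      (m.block v (h - 1)).endDir d ≤ B.endDir d ∧ B.endDir d < m.head (d :: v))
    (hsum : ¬ T.IsLeaf v →
      B.sumEnq = (m.block (.left :: v) (B.endDir .left)).sumEnq +
        (m.block (.right :: v) (B.endDir .right)).sumEnq ∧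
      B.sumDeq = (m.block (.left :: v) (B.endDir .left)).sumDeq +
        (m.block (.right :: v) (B.endDir .right)).sumDeq)
    (hsize : v = [] → B.size ≤ B.sumEnq) :
    Inv T (m.setBlock v h B) G ∧ Ext m G (m.setBlock v h B) G := by
  set m' := m.setBlock v h B with hm'
  have hpos : 1 ≤ h := hh ▸ I.head_pos v
  have hhead : m'.head = m.head := rfl
  have hprev : m.Has v (h - 1) := I.filled (by omega) (by omega)
  have hhas : ∀ {w j}, m'.Has w j → (w = v ∧ j = h) ∨ m.Has w j := Mem.has_setBlock.1
  have hhas' : ∀ {w j}, m.Has w j → m'.Has w j := fun h => Mem.has_setBlock.2 (Or.inr h)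
  have hself : m'.block v h = B := Mem.block_setBlock_self ..
  have hold : ∀ {w j}, m.Has w j → m'.block w j = m.block w j := by
    intro w j hw
    refine Mem.block_setBlock_of_ne _ _ ?_
    rintro ⟨rfl, rfl⟩
    exact hn hw
  have hne : ∀ {w j}, ¬ (w = v ∧ j = h) → m'.block w j = m.block w j :=
    fun hw => Mem.block_setBlock_of_ne _ _ hw
  have hsucc : ∀ {w i}, 0 ≤ i → m'.Has w (i + 1) →
      (w = v ∧ i = h - 1 ∧ i + 1 = h) ∨ (m.Has w (i + 1) ∧ m'.block w (i + 1) = m.block w (i + 1) ∧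
        m'.block w i = m.block w i) := by
    intro w i hi hw
    rcases hhas hw with ⟨rfl, rfl⟩ | hw
    · exact Or.inl ⟨rfl, by omega, rfl⟩
    · exact Or.inr ⟨hw, hold hw, hold (I.has_of_le hi (by omega) hw)⟩
  have hsup : ∀ {w j t}, (m'.block w j).super = some t → (m.block w j).super = some t := by
    intro w j t ht
    by_cases hw : w = v ∧ j = h
    · obtain ⟨rfl, rfl⟩ := hw
      rw [hself, hsuper] at ht
      cases ht
    · rwa [hne hw] at ht
  have L : m.Le m' := by
    refine ⟨fun _ => le_rfl, hhas', ?_, ?_, ?_, ?_⟩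
    · intro w j hw; rw [hold hw]
    · intro w j hw; rw [hold hw]
    · intro w j d hw; rw [hold hw]
    · intro w j t ht
      rw [hold (Mem.has_of_super ht), ht]
  have E : Ext m G m' G := L.ext G hhead
  refine ⟨?_, E⟩
  constructor
  case head_pos => exact I.head_pos
  case zero_sumEnq => intro w; rw [hold (I.has_zero w), I.zero_sumEnq]
  case zero_endDir => intro w d; rw [hold (I.has_zero w), I.zero_endDir]
  case nonneg =>
    intro w i hw
    rcases hhas hw with ⟨rfl, rfl⟩ | hw
    · omega
    · exact I.nonneg hw
  case filled => exact fun h0 h1 => hhas' (I.filled h0 h1)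
  case le_head =>
    intro w i hw
    rcases hhas hw with ⟨rfl, rfl⟩ | hw
    · exact hh.le
    · exact I.le_head hw
  case endDir_nonneg =>
    intro w i hl hw d
    rcases hhas hw with ⟨rfl, rfl⟩ | hw
    · rw [hself]
      exact (I.endDir_nonneg hl hprev d).trans (hend hl d).2.1
    · rw [hold hw]
      exact I.endDir_nonneg hl hw d
  case endDir_lt =>
    intro w i hl hw d
    rw [hhead]
    rcases hhas hw with ⟨rfl, rfl⟩ | hw
    · rw [hself]
      exact (hend hl d).2.2
    · rw [hold hw]
      exact I.endDir_lt hl hw d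
  case sumEnq_eq =>
    intro w i hl hw
    rcases hhas hw with ⟨rfl, rfl⟩ | hw
    · have hc : ∀ d, m.Has (d :: w) (B.endDir d) := fun d =>
        I.filled ((I.endDir_nonneg hl hprev d).trans (hend hl d).2.1) (hend hl d).2.2
      rw [hself, hold (hc .left), hold (hc .right)]
      exact (hsum hl).1
    · rw [hold hw, hold (I.has_endDir hl hw .left), hold (I.has_endDir hl hw .right)]
      exact I.sumEnq_eq hl hw
  case sumDeq_eq =>
    intro w i hl hw
    rcases hhas hw with ⟨rfl, rfl⟩ | hw
    · have hc : ∀ d, m.Has (d :: w) (B.endDir d) := fun d =>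
        I.filled ((I.endDir_nonneg hl hprev d).trans (hend hl d).2.1) (hend hl d).2.2
      rw [hself, hold (hc .left), hold (hc .right)]
      exact (hsum hl).2
    · rw [hold hw, hold (I.has_endDir hl hw .left), hold (I.has_endDir hl hw .right)]
      exact I.sumDeq_eq hl hw
  case sumEnq_le =>
    intro w i h0 hw
    rcases hsucc h0 hw with ⟨rfl, h1, h2⟩ | ⟨hw, h1, h2⟩
    · rw [h2, hself, h1, hold hprev]
      exact hE
    · rw [h1, h2]
      exact I.sumEnq_le h0 hw
  case sumDeq_le =>
    intro w i h0 hw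
    rcases hsucc h0 hw with ⟨rfl, h1, h2⟩ | ⟨hw, h1, h2⟩
    · rw [h2, hself, h1, hold hprev]
      exact hD
    · rw [h1, h2]
      exact I.sumDeq_le h0 hw
  case sum_lt =>
    intro w i h0 hw
    rcases hsucc h0 hw with ⟨rfl, h1, h2⟩ | ⟨hw, h1, h2⟩
    · rw [h2, hself, h1, hold hprev]
      exact hED
    · rw [h1, h2]
      exact I.sum_lt h0 hw
  case endDir_le =>
    intro w i hl h0 hw d
    rcases hsucc h0 hw with ⟨rfl, h1, h2⟩ | ⟨hw, h1, h2⟩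
    · rw [h2, hself, h1, hold hprev]
      exact (hend hl d).2.1
    · rw [h1, h2]
      exact I.endDir_le hl h0 hw d
  case size_le =>
    intro i hw
    rcases hhas hw with ⟨rfl, rfl⟩ | hw
    · rw [hself]
      exact hsize rfl
    · rw [hold hw]
      exact I.size_le hw
  case super_isSome =>
    intro d u i h0 hi
    rw [hold (I.filled h0 hi)]
    exact I.super_isSome h0 hi
  case super_pos => exact fun h1 h2 => I.super_pos h1 (hsup h2)
  case super_le => exact fun h1 h2 => I.super_le h1 (hsup h2)
  case endDir_super_lt =>
    intro d u b s hl h1 h2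
    have h3 := I.super_pos h1 (hsup h2)
    have h4 := I.super_le h1 (hsup h2)
    rw [hold (I.filled (by omega) (by omega))]
    exact I.endDir_super_lt hl h1 (hsup h2)
  case super_marker => exact fun h1 h2 => (I.super_marker h1 (hsup h2)).mono E
  case ghost_has => exact fun u d s => hhas' (I.ghost_has u d s)
  case ghost_le =>
    intro u d s hl h0 hw
    rcases hsucc h0 hw with ⟨rfl, h1, h2⟩ | ⟨hw, h1, h2⟩
    · rw [h2, hself, h1]
      exact (hend hl d).1
    · rw [h1]
      exact I.ghost_le hl h0 hw

end Writes

/-! ### The invariants of the processes -/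

/-- The block `b` of `v` is contained in a block of every ancestor of `v`. -/
def Reach (m : Mem V) : Node → ℤ → Prop
  | [], b => 1 ≤ b ∧ b < m.head []
  | d :: u, b => 1 ≤ b ∧ b < m.head (d :: u) ∧
      ∃ s, s < m.head u ∧ m.Has u s ∧ b ≤ (m.block u s).endDir d ∧ Reach m u s

/-- The owner of `ℓ` is not in the middle of an `Append`: the block that it appended last is before
the position `ℓ.head`. -/
def Clean (m : Mem V) (ℓ : Node) : Prop := ¬ m.Has ℓ (m.head ℓ)

/-- In the course of `Propagate`, the last block appended to the leaf `ℓ` has been propagated to the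
block `c` of the `d`-child of `v`; so it reaches the root as soon as that block does. -/
structure Pending (m : Mem V) (ℓ v : Node) (d : Dir) (c : ℤ) : Prop where
  path : d :: v <:+ ℓ
  clean : Clean m ℓ
  one_le : 1 ≤ c
  lt_head : c < m.head (d :: v)
  chain : ∀ m' : Mem V, m.Le m' → Reach m' (d :: v) c → Reach m' ℓ (m.head ℓ - 1)

/-- The process is in `Refresh(v)`, where it has read `h` from `v.head`. If this is the second
attempt, the block to be propagated was there when `v.head` was less than `h`. -/
structure RefreshInv (m : Mem V) (G : Ghost) (ℓ v : Node) (a : Attempt) (h : ℤ) (d : Dir) (c : ℤ) :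
    Prop extends Pending m ℓ v d c where
  one_le_h : 1 ≤ h
  h_le : h ≤ m.head v
  marked : ∃ s, 1 ≤ s ∧ s ≤ h ∧ (a = .second → s < h) ∧ Marker m G v d c s

/-- The child of `v` in direction `dir` has advanced past all blocks it held when `v.head` became
`h`. -/
def Helped (m : Mem V) (G : Ghost) (v : Node) (h : ℤ) (dir : Dir) : Prop :=
  G v dir (h - 1) < m.head (dir :: v)

/-- The end in direction `dir` of the block `B`, intended for the entry `h` of `v`, covers all that
it has to. -/
structure EndOK (m : Mem V) (G : Ghost) (v : Node) (h : ℤ) (d : Dir) (c : ℤ) (B : Block V)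
    (dir : Dir) : Prop where
  ghost_le : G v dir (h - 1) ≤ B.endDir dir
  prev_le : (m.block v (h - 1)).endDir dir ≤ B.endDir dir
  lt_head : B.endDir dir < m.head (dir :: v)
  target_le : d = dir → c ≤ B.endDir dir

/-- Both ends of the block `B`, intended for the entry `h` of `v`, have been computed. -/
structure Candidate (m : Mem V) (G : Ghost) (ℓ v : Node) (a : Attempt) (h : ℤ) (d : Dir) (c : ℤ)
    (B : Block V) : Prop extends RefreshInv m G ℓ v a h d c where
  ends : ∀ dir, EndOK m G v h d c B dir
  super_eq : B.super = none

/-- The field `sumEnq` of `B` agrees with its ends. -/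
def SumEnqOK (m : Mem V) (v : Node) (B : Block V) : Prop :=
  B.sumEnq = (m.block (.left :: v) B.endLeft).sumEnq + (m.block (.right :: v) B.endRight).sumEnq

/-- The field `sumDeq` of `B` agrees with its ends. -/
def SumDeqOK (m : Mem V) (v : Node) (B : Block V) : Prop :=
  B.sumDeq = (m.block (.left :: v) B.endLeft).sumDeq + (m.block (.right :: v) B.endRight).sumDeq

/-- What the caller of `Advance(w, h)` needs. -/
def CallerInv (m : Mem V) (G : Ghost) (ℓ w : Node) (h : ℤ) : AdvanceCaller → Prop
  | .append => w = ℓ ∧ 1 ≤ h ∧ ∀ k, m.Has ℓ k → k ≤ h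
  | .help v a h' dir => w = dir :: v ∧ ∃ d c, RefreshInv m G ℓ v a h' d c ∧
      (dir = .right → Helped m G v h' .left) ∧ G v dir (h' - 1) ≤ h
  | .final v a result => w = v ∧ ∃ d c, RefreshInv m G ℓ v a h d c ∧
      (result = true → c ≤ (m.block v h).endDir d)

/-- The process runs `IndexDequeue(w, …)` for an ancestor `w` of its leaf. -/
def Climbing (m : Mem V) (ℓ w : Node) : Prop := Clean m ℓ ∧ w <:+ ℓ

/-- The block sought is in `(lo, hi]`. -/
structure SearchInv (m : Mem V) (w : Node) (e lo hi : ℤ) : Prop where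
  nonneg : 0 ≤ lo
  lt : lo < hi
  lt_head : hi < m.head w
  sumEnq_lt : (m.block w lo).sumEnq < e
  le_sumEnq : e ≤ (m.block w hi).sumEnq

/-- `w` is a node of the tree. -/
def InTree (T : OrderingTree p) (w : Node) : Prop := ∃ j, w <:+ T.leaf j

/-- The process looks for the `i`-th enqueue of the block `b` of the internal node `v`. -/
structure GetInv (T : OrderingTree p) (m : Mem V) (v : Node) (b i : ℤ) : Prop where
  inTree : InTree T v
  internal : ¬ T.IsLeaf v
  one_le : 1 ≤ b
  lt_head : b < m.head v
  rank_pos : 1 ≤ i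
  rank_le : i ≤ (m.block v b).sumEnq - (m.block v (b - 1)).sumEnq

/-- The process looks for an enqueue in the `dir`-child of `v`, among the blocks that the block `b`
of `v` contains. -/
structure DescendInv (T : OrderingTree p) (m : Mem V) (v : Node) (b i : ℤ) (dir : Dir) (prev : ℤ) :
    Prop where
  inTree : InTree T v
  internal : ¬ T.IsLeaf v
  one_le : 1 ≤ b
  lt_head : b < m.head v
  prev_eq : prev = (m.block (dir :: v) ((m.block v (b - 1)).endDir dir)).sumEnq
  rank_pos : 1 ≤ i
  rank_le : i + prev ≤ (m.block (dir :: v) ((m.block v b).endDir dir)).sumEnq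

/-- The invariant for the local state of a process whose leaf is `ℓ`. -/
def LocalInv (T : OrderingTree p) (ℓ : Node) (m : Mem V) (G : Ghost) : PC V → Prop
  | .idle _ => Clean m ℓ
  | .fault => False
  | .opHead _ => Clean m ℓ
  | .opSumEnq _ h => Clean m ℓ ∧ h = m.head ℓ
  | .opSumDeq _ h se => Clean m ℓ ∧ h = m.head ℓ ∧ se = (m.block ℓ (h - 1)).sumEnq
  | .appendWrite _ h B => Clean m ℓ ∧ h = m.head ℓ ∧ B.super = none ∧
      (m.block ℓ (h - 1)).sumEnq ≤ B.sumEnq ∧ (m.block ℓ (h - 1)).sumDeq ≤ B.sumDeq ∧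
      (m.block ℓ (h - 1)).sumEnq + (m.block ℓ (h - 1)).sumDeq < B.sumEnq + B.sumDeq
  | .refreshHead _ v a => ∃ d c, Pending m ℓ v d c ∧
      (a = .second → ∃ s, 1 ≤ s ∧ s < m.head v ∧ Marker m G v d c s)
  | .refreshChildHead _ v a h dir => ∃ d c, RefreshInv m G ℓ v a h d c ∧
      (dir = .right → Helped m G v h .left)
  | .refreshTest _ v a h dir k => ∃ d c, RefreshInv m G ℓ v a h d c ∧
      (dir = .right → Helped m G v h .left) ∧ G v dir (h - 1) ≤ k ∧ k ≤ m.head (dir :: v)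
  | .refreshCas _ v a h B => ∃ d c, Candidate m G ℓ v a h d c B ∧ SumEnqOK m v B ∧
      SumDeqOK m v B ∧
      (m.block v (h - 1)).sumEnq + (m.block v (h - 1)).sumDeq ≠ B.sumEnq + B.sumDeq ∧
      (v = [] → B.size ≤ B.sumEnq)
  | .advParentHead _ w h k => m.Has w h ∧ CallerInv m G ℓ w h k ∧ w ≠ []
  | .advSuper _ w h hp k => m.Has w h ∧ CallerInv m G ℓ w h k ∧
      ∃ d u, w = d :: u ∧ 1 ≤ hp ∧ hp ≤ m.head u ∧ Marker m G u d h hp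
  | .advHead _ w h k => m.Has w h ∧ CallerInv m G ℓ w h k ∧
      (w ≠ [] → (m.block w h).super.isSome)
  | .cbEndLeft _ v a h B => ∃ d c, RefreshInv m G ℓ v a h d c ∧ (∀ dir, Helped m G v h dir) ∧
      B.super = none
  | .cbEndRight _ v a h B => ∃ d c, RefreshInv m G ℓ v a h d c ∧ Helped m G v h .right ∧
      EndOK m G v h d c B .left ∧ B.super = none
  | .cbSumEnqLeft _ v a h B => ∃ d c, Candidate m G ℓ v a h d c B
  | .cbSumEnqRight _ v a h B => ∃ d c, Candidate m G ℓ v a h d c B ∧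
      B.sumEnq = (m.block (.left :: v) B.endLeft).sumEnq
  | .cbSumDeqLeft _ v a h B => ∃ d c, Candidate m G ℓ v a h d c B ∧ SumEnqOK m v B
  | .cbSumDeqRight _ v a h B => ∃ d c, Candidate m G ℓ v a h d c B ∧ SumEnqOK m v B ∧
      B.sumDeq = (m.block (.left :: v) B.endLeft).sumDeq
  | .cbNumEnq _ v a h B => ∃ d c, Candidate m G ℓ v a h d c B ∧ SumEnqOK m v B ∧ SumDeqOK m v B
  | .cbNumDeq _ v a h B ne => ∃ d c, Candidate m G ℓ v a h d c B ∧ SumEnqOK m v B ∧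
      SumDeqOK m v B ∧ ne = B.sumEnq - (m.block v (h - 1)).sumEnq
  | .cbSize _ v a h B ne nd => ∃ d c, Candidate m G ℓ v a h d c B ∧ SumEnqOK m v B ∧
      SumDeqOK m v B ∧ ne = B.sumEnq - (m.block v (h - 1)).sumEnq ∧
      nd = B.sumDeq - (m.block v (h - 1)).sumDeq ∧ v = []
  | .deqLeafHead => Clean m ℓ ∧ Reach m ℓ (m.head ℓ - 1)
  | .idSuper u dir b i => Climbing m ℓ (dir :: u) ∧ Reach m (dir :: u) b ∧ 1 ≤ i
  | .idTest u dir b i sup => Climbing m ℓ (dir :: u) ∧ Reach m (dir :: u) b ∧ 1 ≤ i ∧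
      (m.block (dir :: u) b).super = some sup
  | .idPrevSum u dir b i sup => Climbing m ℓ (dir :: u) ∧ Reach m u sup ∧ 1 ≤ i ∧
      (m.block u (sup - 1)).endDir dir < b ∧ b ≤ (m.block u sup).endDir dir
  | .idStart u dir i sup => Climbing m ℓ (dir :: u) ∧ Reach m u sup ∧
      1 ≤ i - (m.block (dir :: u) ((m.block u (sup - 1)).endDir dir)).sumDeq
  | .idStartSum u dir i sup j => Climbing m ℓ (dir :: u) ∧ Reach m u sup ∧ m.Has (dir :: u) j ∧
      1 ≤ i - (m.block (dir :: u) j).sumDeq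
  | .idLeftEnd u i sup => Climbing m ℓ (.right :: u) ∧ Reach m u sup ∧ 1 ≤ i
  | .idLeftEndSum u i sup j => Climbing m ℓ (.right :: u) ∧ Reach m u sup ∧ 1 ≤ i ∧
      j = (m.block u sup).endDir .left
  | .idLeftStart u i sup => Climbing m ℓ (.right :: u) ∧ Reach m u sup ∧
      1 ≤ i - (m.block (.left :: u) ((m.block u (sup - 1)).endDir .left)).sumDeq
  | .idLeftStartSum u i sup j => Climbing m ℓ (.right :: u) ∧ Reach m u sup ∧
      m.Has (.left :: u) j ∧ 1 ≤ i - (m.block (.left :: u) j).sumDeq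
  | .frSumEnq b i => Clean m ℓ ∧ 1 ≤ b ∧ b < m.head [] ∧ 1 ≤ i
  | .frPrevSumEnq b i se => Clean m ℓ ∧ 1 ≤ b ∧ b < m.head [] ∧ 1 ≤ i ∧
      se = (m.block [] b).sumEnq
  | .frPrevSize b i ne pe => Clean m ℓ ∧ 1 ≤ b ∧ b < m.head [] ∧ 1 ≤ i ∧
      pe = (m.block [] (b - 1)).sumEnq ∧ ne + pe = (m.block [] b).sumEnq
  | .frDouble b e hi d => Clean m ℓ ∧ 1 ≤ b ∧ b < m.head [] ∧ 1 ≤ e ∧ 1 ≤ d ∧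
      max 0 (b - d) < hi ∧ hi ≤ b ∧ e ≤ (m.block [] hi).sumEnq
  | .frBinary e lo hi => Clean m ℓ ∧ SearchInv m [] e lo hi ∧ lo + 1 < hi
  | .frRank e be => Clean m ℓ ∧ SearchInv m [] e (be - 1) be
  | .geElement v b => Clean m ℓ ∧ m.Has v b
  | .geEndLeft v b i => Clean m ℓ ∧ GetInv T m v b i
  | .geSumLeft v b i j => Clean m ℓ ∧ GetInv T m v b i ∧ j = (m.block v b).endDir .left
  | .gePrevEndLeft v b i sl => Clean m ℓ ∧ GetInv T m v b i ∧
      sl = (m.block (.left :: v) ((m.block v b).endDir .left)).sumEnq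
  | .gePrevLeft v b i sl j => Clean m ℓ ∧ GetInv T m v b i ∧
      sl = (m.block (.left :: v) ((m.block v b).endDir .left)).sumEnq ∧
      j = (m.block v (b - 1)).endDir .left
  | .gePrevEndRight v b i sl pl => Clean m ℓ ∧ GetInv T m v b i ∧
      sl = (m.block (.left :: v) ((m.block v b).endDir .left)).sumEnq ∧
      pl = (m.block (.left :: v) ((m.block v (b - 1)).endDir .left)).sumEnq
  | .gePrevRight v b i sl pl j => Clean m ℓ ∧ GetInv T m v b i ∧
      sl = (m.block (.left :: v) ((m.block v b).endDir .left)).sumEnq ∧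
      pl = (m.block (.left :: v) ((m.block v (b - 1)).endDir .left)).sumEnq ∧
      j = (m.block v (b - 1)).endDir .right
  | .geLow v b i dir prev => Clean m ℓ ∧ DescendInv T m v b i dir prev
  | .geHigh v b i dir prev lo => Clean m ℓ ∧ DescendInv T m v b i dir prev ∧
      lo = (m.block v (b - 1)).endDir dir
  | .geBinary w i prev lo hi => Clean m ℓ ∧ InTree T w ∧ SearchInv m w (i + prev) lo hi ∧
      lo + 1 < hi
  | .geRank w i prev b' => Clean m ℓ ∧ InTree T w ∧ SearchInv m w (i + prev) (b' - 1) b'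

/-! ### The invariants of a process are stable under the steps of the others -/

theorem Reach.one_le {m : Mem V} {v : Node} {b : ℤ} (h : Reach m v b) : 1 ≤ b := by
  cases v <;> exact h.1

theorem Reach.lt_head {m : Mem V} {v : Node} {b : ℤ} (h : Reach m v b) : b < m.head v := by
  cases v
  · exact h.2
  · exact h.2.1

theorem Reach.mono {m m' : Mem V} (L : m.Le m') : ∀ {v : Node} {b : ℤ}, Reach m v b → Reach m' v b
  | [], _, h => ⟨h.1, h.2.trans_le (L.head _)⟩
  | _ :: _, _, ⟨h1, h2, s, h3, h4, h5, h6⟩ =>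
    ⟨h1, h2.trans_le (L.head _), s, h3.trans_le (L.head _), L.has h4, by rwa [L.endDir _ h4],
      Reach.mono L h6⟩

theorem Reach.of_le {m : Mem V} {v : Node} {b b' : ℤ} (h : Reach m v b) (h1 : 1 ≤ b')
    (h2 : b' ≤ b) : Reach m v b' := by
  cases v with
  | nil => exact ⟨h1, h2.trans_lt h.2⟩
  | cons d u =>
    obtain ⟨_, h4, s, h5, h6, h7, h8⟩ := h
    exact ⟨h1, h2.trans_lt h4, s, h5, h6, h2.trans h7, h8⟩

theorem not_isLeaf_of_cons_suffix {T : OrderingTree p} {d : Dir} {u : Node} {j : Fin p}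
    (h : d :: u <:+ T.leaf j) : ¬ T.IsLeaf u := by
  rintro ⟨i, rfl⟩
  have h' : T.leaf i <:+ T.leaf j := (List.suffix_cons d _).trans h
  obtain rfl := T.leaf_not_suffix i j h'
  have := h.length_le
  simp at this

section Stability

variable {T : OrderingTree p} {m m' : Mem V} {G G' : Ghost} {j : Fin p}
  (I : Inv T m G) (I' : Inv T m' G') (E : Ext m G m' G')
  (N : ∀ k, m'.Has (T.leaf j) k → m.Has (T.leaf j) k)

include I I' E N in
theorem head_eq_of_clean (h : Clean m (T.leaf j)) : m'.head (T.leaf j) = m.head (T.leaf j) := by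
  rcases (E.head (T.leaf j)).eq_or_lt with h1 | h1
  · exact h1.symm
  · exact absurd (N _ (I'.filled (by have := I.head_pos (T.leaf j); omega) h1)) h

include I I' E N in
theorem Clean.mono (h : Clean m (T.leaf j)) : Clean m' (T.leaf j) := by
  rw [Clean, head_eq_of_clean I I' E N h]
  exact fun h' => h (N _ h')

include I I' E N in
theorem Pending.mono {v : Node} {d : Dir} {c : ℤ} (h : Pending m (T.leaf j) v d c) :
    Pending m' (T.leaf j) v d c where
  path := h.path
  clean := h.clean.mono I I' E N
  one_le := h.one_le
  lt_head := h.lt_head.trans_le (E.head _)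
  chain m'' L := by
    rw [head_eq_of_clean I I' E N h.clean]
    exact h.chain m'' (E.toLe.trans L)

include I I' E N in
theorem RefreshInv.mono {v : Node} {a : Attempt} {h : ℤ} {d : Dir} {c : ℤ}
    (R : RefreshInv m G (T.leaf j) v a h d c) : RefreshInv m' G' (T.leaf j) v a h d c where
  toPending := R.toPending.mono I I' E N
  one_le_h := R.one_le_h
  h_le := R.h_le.trans (E.head _)
  marked := by
    obtain ⟨s, h0, h1, h2, h3⟩ := R.marked
    exact ⟨s, h0, h1, h2, h3.mono E⟩

theorem RefreshInv.internal {v : Node} {a : Attempt} {h : ℤ} {d : Dir} {c : ℤ}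
    (R : RefreshInv m G (T.leaf j) v a h d c) : ¬ T.IsLeaf v :=
  not_isLeaf_of_cons_suffix R.path

include I in
theorem RefreshInv.has_prev {ℓ v : Node} {a : Attempt} {h : ℤ} {d : Dir} {c : ℤ}
    (R : RefreshInv m G ℓ v a h d c) : m.Has v (h - 1) :=
  I.filled (by have := R.one_le_h; omega) (by have := R.h_le; omega)

include E in
theorem Helped.mono {v : Node} {h : ℤ} {dir : Dir} (hh : h ≤ m.head v) (H : Helped m G v h dir) :
    Helped m' G' v h dir := by
  rw [Helped, E.frozen _ _ _ (by omega)]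
  exact H.trans_le (E.head _)

include E in
theorem EndOK.mono {v : Node} {h : ℤ} {d : Dir} {c : ℤ} {B : Block V} {dir : Dir}
    (hh : h ≤ m.head v) (hp : m.Has v (h - 1)) (H : EndOK m G v h d c B dir) :
    EndOK m' G' v h d c B dir where
  ghost_le := by
    rw [E.frozen _ _ _ (by omega)]
    exact H.ghost_le
  prev_le := by
    rw [E.endDir _ hp]
    exact H.prev_le
  lt_head := H.lt_head.trans_le (E.head _)
  target_le := H.target_le

include I I' E N in
theorem Candidate.mono {v : Node} {a : Attempt} {h : ℤ} {d : Dir} {c : ℤ} {B : Block V}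
    (R : Candidate m G (T.leaf j) v a h d c B) : Candidate m' G' (T.leaf j) v a h d c B where
  toRefreshInv := R.toRefreshInv.mono I I' E N
  ends dir := (R.ends dir).mono E R.h_le (R.has_prev I)
  super_eq := R.super_eq

include I in
theorem Candidate.has_end {v : Node} {a : Attempt} {h : ℤ} {d : Dir} {c : ℤ} {B : Block V}
    (R : Candidate m G (T.leaf j) v a h d c B) (dir : Dir) : m.Has (dir :: v) (B.endDir dir) :=
  I.filled ((I.endDir_nonneg R.internal (R.has_prev I) dir).trans (R.ends dir).prev_le)
    (R.ends dir).lt_head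

include I in
theorem Candidate.has_endLeft {v : Node} {a : Attempt} {h : ℤ} {d : Dir} {c : ℤ} {B : Block V}
    (R : Candidate m G (T.leaf j) v a h d c B) : m.Has (.left :: v) B.endLeft :=
  R.has_end I .left

include I in
theorem Candidate.has_endRight {v : Node} {a : Attempt} {h : ℤ} {d : Dir} {c : ℤ} {B : Block V}
    (R : Candidate m G (T.leaf j) v a h d c B) : m.Has (.right :: v) B.endRight :=
  R.has_end I .right

include I E in
theorem Candidate.sumEnqOK_mono {v : Node} {a : Attempt} {h : ℤ} {d : Dir} {c : ℤ} {B : Block V}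
    (R : Candidate m G (T.leaf j) v a h d c B) (S : SumEnqOK m v B) : SumEnqOK m' v B := by
  rw [SumEnqOK, E.sumEnq (R.has_endLeft I), E.sumEnq (R.has_endRight I)]
  exact S

include I E in
theorem Candidate.sumDeqOK_mono {v : Node} {a : Attempt} {h : ℤ} {d : Dir} {c : ℤ} {B : Block V}
    (R : Candidate m G (T.leaf j) v a h d c B) (S : SumDeqOK m v B) : SumDeqOK m' v B := by
  rw [SumDeqOK, E.sumDeq (R.has_endLeft I), E.sumDeq (R.has_endRight I)]
  exact S

include I I' E N in
theorem CallerInv.mono {w : Node} {h : ℤ} {k : AdvanceCaller} (hw : m.Has w h)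
    (C : CallerInv m G (T.leaf j) w h k) : CallerInv m' G' (T.leaf j) w h k := by
  rcases k with _ | ⟨v, a, h', dir⟩ | ⟨v, a, r⟩
  · exact ⟨C.1, C.2.1, fun k hk => C.2.2 k (N k hk)⟩
  · obtain ⟨rfl, d, c, R, C1, C2⟩ := C
    refine ⟨rfl, d, c, R.mono I I' E N, fun hd => (C1 hd).mono E R.h_le, ?_⟩
    rwa [E.frozen _ _ _ (by have := R.h_le; omega)]
  · obtain ⟨rfl, d, c, R, C⟩ := C
    refine ⟨rfl, d, c, R.mono I I' E N, fun hr => ?_⟩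
    rw [E.endDir _ hw]
    exact C hr

include I I' E N in
theorem Climbing.mono {w : Node} (C : Climbing m (T.leaf j) w) : Climbing m' (T.leaf j) w :=
  ⟨C.1.mono I I' E N, C.2⟩

include I in
theorem Reach.has {v : Node} {b : ℤ} (h : Reach m v b) : m.Has v b :=
  I.filled (by have := h.one_le; omega) h.lt_head

include I in
theorem Reach.has_prev {v : Node} {b : ℤ} (h : Reach m v b) : m.Has v (b - 1) :=
  I.filled (by have := h.one_le; omega) (by have := h.lt_head; omega)

include I E in
theorem SearchInv.mono {w : Node} {e lo hi : ℤ} (S : SearchInv m w e lo hi) :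
    SearchInv m' w e lo hi where
  nonneg := S.nonneg
  lt := S.lt
  lt_head := S.lt_head.trans_le (E.head _)
  sumEnq_lt := by
    rw [E.sumEnq (I.filled S.nonneg (S.lt.trans S.lt_head))]
    exact S.sumEnq_lt
  le_sumEnq := by
    rw [E.sumEnq (I.filled (S.nonneg.trans S.lt.le) S.lt_head)]
    exact S.le_sumEnq

include I in
theorem GetInv.has {v : Node} {b i : ℤ} (Q : GetInv T m v b i) : m.Has v b :=
  I.filled (by have := Q.one_le; omega) Q.lt_head

include I in
theorem GetInv.has_prev {v : Node} {b i : ℤ} (Q : GetInv T m v b i) : m.Has v (b - 1) :=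
  I.filled (by have := Q.one_le; omega) (by have := Q.lt_head; omega)

include I E in
theorem GetInv.mono {v : Node} {b i : ℤ} (Q : GetInv T m v b i) : GetInv T m' v b i where
  inTree := Q.inTree
  internal := Q.internal
  one_le := Q.one_le
  lt_head := Q.lt_head.trans_le (E.head _)
  rank_pos := Q.rank_pos
  rank_le := by
    rw [E.sumEnq (Q.has I), E.sumEnq (Q.has_prev I)]
    exact Q.rank_le

include I in
theorem DescendInv.has {v : Node} {b i : ℤ} {dir : Dir} {prev : ℤ}
    (Q : DescendInv T m v b i dir prev) : m.Has v b :=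
  I.filled (by have := Q.one_le; omega) Q.lt_head

include I in
theorem DescendInv.has_prev {v : Node} {b i : ℤ} {dir : Dir} {prev : ℤ}
    (Q : DescendInv T m v b i dir prev) : m.Has v (b - 1) :=
  I.filled (by have := Q.one_le; omega) (by have := Q.lt_head; omega)

include I E in
theorem sumEnq_endDir_eq {v : Node} {b : ℤ} (hv : ¬ T.IsLeaf v) (hb : m.Has v b) (d : Dir) :
    (m'.block (d :: v) ((m'.block v b).endDir d)).sumEnq =
      (m.block (d :: v) ((m.block v b).endDir d)).sumEnq := by
  rw [E.endDir _ hb, E.sumEnq (I.has_endDir hv hb d)]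

include I E in
theorem sumDeq_endDir_eq {v : Node} {b : ℤ} (hv : ¬ T.IsLeaf v) (hb : m.Has v b) (d : Dir) :
    (m'.block (d :: v) ((m'.block v b).endDir d)).sumDeq =
      (m.block (d :: v) ((m.block v b).endDir d)).sumDeq := by
  rw [E.endDir _ hb, E.sumDeq (I.has_endDir hv hb d)]

include I E in
theorem DescendInv.mono {v : Node} {b i : ℤ} {dir : Dir} {prev : ℤ}
    (Q : DescendInv T m v b i dir prev) : DescendInv T m' v b i dir prev where
  inTree := Q.inTree
  internal := Q.internal
  one_le := Q.one_le
  lt_head := Q.lt_head.trans_le (E.head _)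
  prev_eq := by
    rw [sumEnq_endDir_eq I E Q.internal (Q.has_prev I)]
    exact Q.prev_eq
  rank_pos := Q.rank_pos
  rank_le := by
    rw [sumEnq_endDir_eq I E Q.internal (Q.has I)]
    exact Q.rank_le

theorem Climbing.internal {d : Dir} {u : Node} (C : Climbing m (T.leaf j) (d :: u)) :
    ¬ T.IsLeaf u := not_isLeaf_of_cons_suffix C.2

include I I' E N in
/-- The local invariant of a process survives any growth of the memory in which nothing is written
to the array of its leaf. -/
theorem LocalInv.mono {pc : PC V} (H : LocalInv T (T.leaf j) m G pc) :
    LocalInv T (T.leaf j) m' G' pc := by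
  have hc := Clean.mono I I' E N
  have hh := head_eq_of_clean I I' E N
  have hprev : ∀ {h}, h = m.head (T.leaf j) → m.Has (T.leaf j) (h - 1) := by
    rintro h rfl
    have := I.head_pos (T.leaf j)
    exact I.filled (by omega) (by omega)
  have hroot : ∀ {b}, 0 ≤ b → b < m.head [] → m.Has [] b := I.filled
  have hhead := E.head
  have hr := hhead []
  cases pc <;> simp only [LocalInv] at H ⊢
  case idle => exact hc H
  case opHead => exact hc H
  case opSumEnq => exact ⟨hc H.1, H.2.trans (hh H.1).symm⟩
  case opSumDeq =>
    refine ⟨hc H.1, H.2.1.trans (hh H.1).symm, ?_⟩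
    rw [E.sumEnq (hprev H.2.1)]
    exact H.2.2
  case appendWrite =>
    refine ⟨hc H.1, H.2.1.trans (hh H.1).symm, ?_⟩
    rw [E.sumEnq (hprev H.2.1), E.sumDeq (hprev H.2.1)]
    exact H.2.2
  case refreshHead =>
    obtain ⟨d, c, P, M⟩ := H
    refine ⟨d, c, P.mono I I' E N, fun ha => ?_⟩
    obtain ⟨s, h0, hs, M⟩ := M ha
    exact ⟨s, h0, hs.trans_le (hhead _), M.mono E⟩
  case refreshChildHead =>
    obtain ⟨d, c, R, H⟩ := H
    exact ⟨d, c, R.mono I I' E N, fun hd => (H hd).mono E R.h_le⟩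
  case refreshTest =>
    obtain ⟨d, c, R, H, h1, h2⟩ := H
    refine ⟨d, c, R.mono I I' E N, fun hd => (H hd).mono E R.h_le, ?_, h2.trans (hhead _)⟩
    rwa [E.frozen _ _ _ (by have := R.h_le; omega)]
  case refreshCas =>
    obtain ⟨d, c, R, h1, h2, h3⟩ := H
    refine ⟨d, c, R.mono I I' E N, R.sumEnqOK_mono I E h1, R.sumDeqOK_mono I E h2, ?_⟩
    rw [E.sumEnq (R.has_prev I), E.sumDeq (R.has_prev I)]
    exact h3
  case advParentHead => exact ⟨E.has H.1, H.2.1.mono I I' E N H.1, H.2.2⟩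
  case advSuper =>
    obtain ⟨h1, h2, d, u, h3, h4, h5, h6⟩ := H
    exact ⟨E.has h1, h2.mono I I' E N h1, d, u, h3, h4, h5.trans (hhead _), h6.mono E⟩
  case advHead =>
    refine ⟨E.has H.1, H.2.1.mono I I' E N H.1, fun hw => ?_⟩
    obtain ⟨s, hs⟩ := Option.isSome_iff_exists.1 (H.2.2 hw)
    rw [E.super hs]
    rfl
  case cbEndLeft =>
    obtain ⟨d, c, R, h1, h2⟩ := H
    exact ⟨d, c, R.mono I I' E N, fun dir => (h1 dir).mono E R.h_le, h2⟩
  case cbEndRight =>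
    obtain ⟨d, c, R, h1, h2, h3⟩ := H
    exact ⟨d, c, R.mono I I' E N, h1.mono E R.h_le, h2.mono E R.h_le (R.has_prev I), h3⟩
  case cbSumEnqLeft =>
    obtain ⟨d, c, R⟩ := H
    exact ⟨d, c, R.mono I I' E N⟩
  case cbSumEnqRight =>
    obtain ⟨d, c, R, h1⟩ := H
    refine ⟨d, c, R.mono I I' E N, ?_⟩
    rwa [E.sumEnq (R.has_endLeft I)]
  case cbSumDeqLeft =>
    obtain ⟨d, c, R, h1⟩ := H
    exact ⟨d, c, R.mono I I' E N, R.sumEnqOK_mono I E h1⟩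
  case cbSumDeqRight =>
    obtain ⟨d, c, R, h1, h2⟩ := H
    refine ⟨d, c, R.mono I I' E N, R.sumEnqOK_mono I E h1, ?_⟩
    rwa [E.sumDeq (R.has_endLeft I)]
  case cbNumEnq =>
    obtain ⟨d, c, R, h1, h2⟩ := H
    exact ⟨d, c, R.mono I I' E N, R.sumEnqOK_mono I E h1, R.sumDeqOK_mono I E h2⟩
  case cbNumDeq =>
    obtain ⟨d, c, R, h1, h2, h3⟩ := H
    refine ⟨d, c, R.mono I I' E N, R.sumEnqOK_mono I E h1, R.sumDeqOK_mono I E h2, ?_⟩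
    rwa [E.sumEnq (R.has_prev I)]
  case cbSize =>
    obtain ⟨d, c, R, h1, h2, h3⟩ := H
    refine ⟨d, c, R.mono I I' E N, R.sumEnqOK_mono I E h1, R.sumDeqOK_mono I E h2, ?_⟩
    rwa [E.sumEnq (R.has_prev I), E.sumDeq (R.has_prev I)]
  case deqLeafHead => exact ⟨hc H.1, by rw [hh H.1]; exact H.2.mono E.toLe⟩
  case idSuper => exact ⟨H.1.mono I I' E N, H.2.1.mono E.toLe, H.2.2⟩
  case idTest => exact ⟨H.1.mono I I' E N, H.2.1.mono E.toLe, H.2.2.1, E.super H.2.2.2⟩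
  case idPrevSum =>
    refine ⟨H.1.mono I I' E N, H.2.1.mono E.toLe, H.2.2.1, ?_⟩
    rw [E.endDir _ (H.2.1.has I), E.endDir _ (H.2.1.has_prev I)]
    exact H.2.2.2
  case idStart =>
    refine ⟨H.1.mono I I' E N, H.2.1.mono E.toLe, ?_⟩
    rw [sumDeq_endDir_eq I E H.1.internal (H.2.1.has_prev I)]
    exact H.2.2
  case idStartSum =>
    refine ⟨H.1.mono I I' E N, H.2.1.mono E.toLe, E.has H.2.2.1, ?_⟩
    rw [E.sumDeq H.2.2.1]
    exact H.2.2.2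
  case idLeftEnd => exact ⟨H.1.mono I I' E N, H.2.1.mono E.toLe, H.2.2⟩
  case idLeftEndSum =>
    refine ⟨H.1.mono I I' E N, H.2.1.mono E.toLe, H.2.2.1, ?_⟩
    rw [E.endDir _ (H.2.1.has I)]
    exact H.2.2.2
  case idLeftStart =>
    refine ⟨H.1.mono I I' E N, H.2.1.mono E.toLe, ?_⟩
    rw [sumDeq_endDir_eq I E H.1.internal (H.2.1.has_prev I)]
    exact H.2.2
  case idLeftStartSum =>
    refine ⟨H.1.mono I I' E N, H.2.1.mono E.toLe, E.has H.2.2.1, ?_⟩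
    rw [E.sumDeq H.2.2.1]
    exact H.2.2.2
  case frSumEnq => exact ⟨hc H.1, H.2.1, H.2.2.1.trans_le hr, H.2.2.2⟩
  case frPrevSumEnq =>
    obtain ⟨h0, h1, h2, h3, h4⟩ := H
    refine ⟨hc h0, h1, h2.trans_le hr, h3, ?_⟩
    rwa [E.sumEnq (hroot (by omega) h2)]
  case frPrevSize =>
    obtain ⟨h0, h1, h2, h3, h4, h5⟩ := H
    refine ⟨hc h0, h1, h2.trans_le hr, h3, ?_⟩
    rw [E.sumEnq (hroot (by omega) h2), E.sumEnq (hroot (by omega) (by omega))]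
    exact ⟨h4, h5⟩
  case frDouble =>
    obtain ⟨h0, h1, h2, h3, h4, h5, h6, h7⟩ := H
    refine ⟨hc h0, h1, h2.trans_le hr, h3, h4, h5, h6, ?_⟩
    rwa [E.sumEnq (hroot (by omega) (by omega))]
  case frBinary => exact ⟨hc H.1, H.2.1.mono I E, H.2.2⟩
  case frRank => exact ⟨hc H.1, H.2.mono I E⟩
  case geElement => exact ⟨hc H.1, E.has H.2⟩
  case geEndLeft => exact ⟨hc H.1, H.2.mono I E⟩
  case geSumLeft =>
    refine ⟨hc H.1, H.2.1.mono I E, ?_⟩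
    rw [E.endDir _ (H.2.1.has I)]
    exact H.2.2
  case gePrevEndLeft =>
    refine ⟨hc H.1, H.2.1.mono I E, ?_⟩
    rw [sumEnq_endDir_eq I E H.2.1.internal (H.2.1.has I)]
    exact H.2.2
  case gePrevLeft =>
    refine ⟨hc H.1, H.2.1.mono I E, ?_⟩
    rw [sumEnq_endDir_eq I E H.2.1.internal (H.2.1.has I), E.endDir _ (H.2.1.has_prev I)]
    exact H.2.2
  case gePrevEndRight =>
    refine ⟨hc H.1, H.2.1.mono I E, ?_⟩
    rw [sumEnq_endDir_eq I E H.2.1.internal (H.2.1.has I),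
      sumEnq_endDir_eq I E H.2.1.internal (H.2.1.has_prev I)]
    exact H.2.2
  case gePrevRight =>
    refine ⟨hc H.1, H.2.1.mono I E, ?_⟩
    rw [sumEnq_endDir_eq I E H.2.1.internal (H.2.1.has I),
      sumEnq_endDir_eq I E H.2.1.internal (H.2.1.has_prev I), E.endDir _ (H.2.1.has_prev I)]
    exact H.2.2
  case geLow => exact ⟨hc H.1, H.2.mono I E⟩
  case geHigh =>
    refine ⟨hc H.1, H.2.1.mono I E, ?_⟩
    rw [E.endDir _ (H.2.1.has_prev I)]
    exact H.2.2
  case geBinary => exact ⟨hc H.1, H.2.1, H.2.2.1.mono I E, H.2.2.2⟩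
  case geRank => exact ⟨hc H.1, H.2.1, H.2.2.mono I E⟩

end Stability

/-! ### Every step preserves the invariants -/

theorem leaf_ne_nil (T : OrderingTree p) (hp : 2 ≤ p) (i : Fin p) : T.leaf i ≠ [] := by
  intro hl
  have h01 : ∀ j, i = j := fun j => T.leaf_not_suffix i j (by rw [hl]; exact List.nil_suffix)
  have := (h01 ⟨0, by omega⟩).symm.trans (h01 ⟨1, by omega⟩)
  simp at this

section Control

variable {T : OrderingTree p} {m : Mem V} {G : Ghost} {i : Fin p} (I : Inv T m G)

theorem localInv_callAdvance {op : Op V} {w : Node} {h : ℤ} {k : AdvanceCaller} (hw : m.Has w h)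
    (C : CallerInv m G (T.leaf i) w h k) :
    LocalInv T (T.leaf i) m G (callAdvance op w h k) := by
  unfold callAdvance
  split_ifs with h0
  · exact ⟨hw, C, fun h => absurd h0 h⟩
  · exact ⟨hw, C, h0⟩

include I in
/-- `Propagate` is done with `v`: the pending block is contained in the block `s` of `v`, so `s` takes
its place as the block to be propagated further. -/
theorem Pending.returnRefresh {op : Op V} {v : Node} {a : Attempt} {result : Bool} {d : Dir}
    {c s : ℤ} (P : Pending m (T.leaf i) v d c) (hs : s < m.head v) (hv : m.Has v s)
    (hc : c ≤ (m.block v s).endDir d) (hr : ¬ (result = false ∧ a = .first)) :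
    LocalInv T (T.leaf i) m G (returnRefresh op v a result) := by
  have hs0 : 1 ≤ s := by
    have h0 := I.nonneg hv
    by_contra hn
    obtain rfl : s = 0 := by omega
    rw [I.zero_endDir] at hc
    have := P.one_le
    omega
  have hchain : ∀ m' : Mem V, m.Le m' → Reach m' v s → Reach m' (T.leaf i) (m.head (T.leaf i) - 1) :=
    fun m' L hR => P.chain m' L ⟨P.one_le, P.lt_head.trans_le (L.head _), s, hs.trans_le (L.head _),
      L.has hv, by rwa [L.endDir _ hv], hR⟩
  unfold WFQueue.returnRefresh
  rw [if_neg hr]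
  cases v with
  | nil =>
    cases op with
    | enqueue e => exact P.clean
    | dequeue => exact ⟨P.clean, hchain m (Mem.Le.refl m) ⟨hs0, hs⟩⟩
  | cons d' u =>
    exact ⟨d', s, ⟨(List.suffix_cons d _).trans P.path, P.clean, hs0, hs, hchain⟩,
      fun h => by cases h⟩

theorem localInv_returnAdvance_help {op : Op V} {v : Node} {a : Attempt} {h : ℤ} {dir d : Dir}
    {c : ℤ} (R : RefreshInv m G (T.leaf i) v a h d c) (hl : dir = .right → Helped m G v h .left)
    (hd : Helped m G v h dir) :
    LocalInv T (T.leaf i) m G (returnAdvance op (T.leaf i) (.help v a h dir)) := by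
  cases dir with
  | left => exact ⟨d, c, R, fun _ => hd⟩
  | right =>
    refine ⟨d, c, R, ?_, rfl⟩
    rintro (_ | _)
    · exact hl rfl
    · exact hd

include I in
/-- The return of `Advance(w, h)` to its caller. At the end of a second failed attempt of
`Refresh(v)`, the block that won is the work of a `Refresh` that began after the first attempt of
this process had read `v.head`, so that it contains the pending block. -/
theorem localInv_returnAdvance (hp : 2 ≤ p) {op : Op V} {w : Node} {h : ℤ} {k : AdvanceCaller}
    (hw : m.Has w h) (hh : h < m.head w) (C : CallerInv m G (T.leaf i) w h k) :
    LocalInv T (T.leaf i) m G (returnAdvance op (T.leaf i) k) := by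
  rcases k with _ | ⟨v, a, h', dir⟩ | ⟨v, a, r⟩
  · obtain ⟨rfl, h1, h2⟩ := C
    have hclean : Clean m (T.leaf i) := by
      intro hc
      have := h2 _ hc
      omega
    have hhead : m.head (T.leaf i) - 1 = h := by
      have := h2 (m.head (T.leaf i) - 1)
        (I.filled (by have := I.head_pos (T.leaf i); omega) (by omega))
      omega
    obtain ⟨d, u, hl⟩ := List.exists_cons_of_ne_nil (leaf_ne_nil T hp i)
    refine ⟨d, h, ⟨?_, hclean, h1, ?_, ?_⟩, fun h => by cases h⟩
    · rw [hl]; exact List.suffix_rfl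
    · rw [hl] at hh ⊢
      exact hh
    · intro m' _ hR
      rw [hhead]
      rw [hl] at hR ⊢
      exact hR
  · obtain ⟨rfl, d, c, R, C1, C2⟩ := C
    exact localInv_returnAdvance_help R C1 (C2.trans_lt hh)
  · obtain ⟨rfl, d, c, R, C⟩ := C
    have P := R.toPending
    obtain ⟨s, hs0, hsh, hs2, M⟩ := R.marked
    cases r with
    | true => exact P.returnRefresh I hh hw (C rfl) (by simp)
    | false =>
      cases a with
      | first =>
        have : WFQueue.returnRefresh op w .first false = .refreshHead op w .second := by
          simp [WFQueue.returnRefresh]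
        change LocalInv T _ m G (WFQueue.returnRefresh op w .first false)
        rw [this]
        exact ⟨d, c, P, fun _ => ⟨s, hs0, by omega, M⟩⟩
      | second =>
        have hs3 := hs2 rfl
        have h1 := I.ghost_le (d := d) R.internal (by omega : 0 ≤ s)
          (I.has_of_le (by omega) (by omega : s + 1 ≤ h) hw)
        have h2 := I.endDir_mono R.internal (by omega) (by omega : s + 1 ≤ h) hw d
        exact P.returnRefresh I hh hw (((M.2 (by omega)).trans h1).trans h2) (by simp)

theorem Candidate.congr {ℓ v : Node} {a : Attempt} {h : ℤ} {d : Dir} {c : ℤ} {B B' : Block V}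
    (R : Candidate m G ℓ v a h d c B) (he : ∀ dir, B'.endDir dir = B.endDir dir)
    (hs : B'.super = B.super) : Candidate m G ℓ v a h d c B' where
  toRefreshInv := R.toRefreshInv
  ends dir := by
    obtain ⟨h1, h2, h3, h4⟩ := R.ends dir
    constructor <;> rw [he] <;> assumption
  super_eq := hs.trans R.super_eq

section Candidate

variable {v : Node} {a : Attempt} {h : ℤ} {d : Dir} {c : ℤ} {B : Block V}
  (R : Candidate m G (T.leaf i) v a h d c B)

include I R in
theorem Candidate.sumEnq_le (S : SumEnqOK m v B) : (m.block v (h - 1)).sumEnq ≤ B.sumEnq := by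
  have hp := R.has_prev I
  rw [S, I.sumEnq_eq R.internal hp]
  exact add_le_add
    (I.sumEnq_mono (I.endDir_nonneg R.internal hp _) (R.ends .left).prev_le (R.has_endLeft I))
    (I.sumEnq_mono (I.endDir_nonneg R.internal hp _) (R.ends .right).prev_le (R.has_endRight I))

include I R in
theorem Candidate.sumDeq_le (S : SumDeqOK m v B) : (m.block v (h - 1)).sumDeq ≤ B.sumDeq := by
  have hp := R.has_prev I
  rw [S, I.sumDeq_eq R.internal hp]
  exact add_le_add
    (I.sumDeq_mono (I.endDir_nonneg R.internal hp _) (R.ends .left).prev_le (R.has_endLeft I))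
    (I.sumDeq_mono (I.endDir_nonneg R.internal hp _) (R.ends .right).prev_le (R.has_endRight I))

include I R in
/-- If the new block would be empty, its ends are those of the preceding block. -/
theorem Candidate.endDir_eq (S : SumEnqOK m v B) (S' : SumDeqOK m v B)
    (h0 : B.sumEnq + B.sumDeq = (m.block v (h - 1)).sumEnq + (m.block v (h - 1)).sumDeq)
    (dir : Dir) : B.endDir dir = (m.block v (h - 1)).endDir dir := by
  have hp := R.has_prev I
  have hE := I.sumEnq_eq R.internal hp
  have hD := I.sumDeq_eq R.internal hp
  have hnn := I.endDir_nonneg R.internal hp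
  have e1 := I.sumEnq_mono (hnn .left) (R.ends .left).prev_le (R.has_end I .left)
  have e2 := I.sumEnq_mono (hnn .right) (R.ends .right).prev_le (R.has_end I .right)
  have d1 := I.sumDeq_mono (hnn .left) (R.ends .left).prev_le (R.has_end I .left)
  have d2 := I.sumDeq_mono (hnn .right) (R.ends .right).prev_le (R.has_end I .right)
  have S1 : B.sumEnq = (m.block (.left :: v) (B.endDir .left)).sumEnq +
    (m.block (.right :: v) (B.endDir .right)).sumEnq := S
  have S2 : B.sumDeq = (m.block (.left :: v) (B.endDir .left)).sumDeq +
    (m.block (.right :: v) (B.endDir .right)).sumDeq := S'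
  refine le_antisymm ?_ (R.ends dir).prev_le
  by_contra hlt
  have hs := I.sum_strictMono (hnn dir) (not_le.1 hlt) (R.has_end I dir)
  cases dir <;> omega

include I R in
theorem localInv_returnCreateBlock {op : Op V} {ne nd : ℤ} (S : SumEnqOK m v B)
    (S' : SumDeqOK m v B) (hne : ne = B.sumEnq - (m.block v (h - 1)).sumEnq)
    (hnd : nd = B.sumDeq - (m.block v (h - 1)).sumDeq) (hsize : v = [] → B.size ≤ B.sumEnq) :
    LocalInv T (T.leaf i) m G (returnCreateBlock op v a h B ne nd) := by
  unfold returnCreateBlock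
  split_ifs with h0
  · refine R.toPending.returnRefresh I (s := h - 1) (by have := R.h_le; omega) (R.has_prev I) ?_
      (by simp)
    rw [← R.endDir_eq I S S' (by omega)]
    exact (R.ends d).target_le rfl
  · exact ⟨d, c, R, S, S', by omega, hsize⟩

end Candidate

theorem localInv_callIndexDequeue {w : Node} {b k : ℤ} (hc : Clean m (T.leaf i))
    (hw : w <:+ T.leaf i) (hR : Reach m w b) (hk : 1 ≤ k) :
    LocalInv T (T.leaf i) m G (callIndexDequeue w b k) := by
  cases w with
  | nil => exact ⟨hc, hR.1, hR.2, hk⟩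
  | cons d u => exact ⟨⟨hc, hw⟩, hR, hk⟩

theorem localInv_frLoop {e lo hi : ℤ} (hc : Clean m (T.leaf i)) (S : SearchInv m [] e lo hi) :
    LocalInv T (T.leaf i) m G (frLoop e lo hi) := by
  unfold frLoop
  split_ifs with h
  · exact ⟨hc, S, h⟩
  · obtain rfl : lo = hi - 1 := by have := S.lt; omega
    exact ⟨hc, S⟩

theorem localInv_geLoop {w : Node} {k prev lo hi : ℤ} (hc : Clean m (T.leaf i)) (hw : InTree T w)
    (S : SearchInv m w (k + prev) lo hi) :
    LocalInv T (T.leaf i) m G (geLoop w k prev lo hi) := by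
  unfold geLoop
  split_ifs with h
  · exact ⟨hc, hw, S, h⟩
  · obtain rfl : lo = hi - 1 := by have := S.lt; omega
    exact ⟨hc, hw, S⟩

include I in
theorem localInv_callGetEnqueue {w : Node} {e b : ℤ} (hc : Clean m (T.leaf i)) (hw : InTree T w)
    (S : SearchInv m w e (b - 1) b) :
    LocalInv T (T.leaf i) m G
      (callGetEnqueue T w b (e - (m.block w (b - 1)).sumEnq)) := by
  obtain ⟨h1, h2, h3, h4, h5⟩ := S
  unfold callGetEnqueue
  split_ifs with hl
  · exact ⟨hc, I.filled (by omega) h3⟩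
  · exact ⟨hc, hw, hl, by omega, h3, by omega, by omega⟩

theorem InTree.cons {v : Node} (h : InTree T v) (hl : ¬ T.IsLeaf v) (dir : Dir) :
    InTree T (dir :: v) := by
  obtain ⟨j, l, hj⟩ := h
  rcases List.eq_nil_or_concat l with rfl | ⟨l', d, rfl⟩
  · exact absurd ⟨j, hj.symm⟩ hl
  · obtain ⟨j', h'⟩ := T.full j d v ⟨l', by simpa using hj⟩ dir
    exact ⟨j', h'⟩

end Control

/-- The step of process `i` from the memory `m` to the configuration `r` preserves the global
invariant, establishes the local invariant of `i`, and does not write to the leaves of the other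
processes. -/
def StepOK (T : OrderingTree p) (i : Fin p) (m : Mem V) (G : Ghost) (r : Mem V × PC V) : Prop :=
  ∃ G', Inv T r.1 G' ∧ Ext m G r.1 G' ∧
    (∀ j ≠ i, ∀ k, r.1.Has (T.leaf j) k → m.Has (T.leaf j) k) ∧ LocalInv T (T.leaf i) r.1 G' r.2

section Step

variable {T : OrderingTree p} {m : Mem V} {G : Ghost} {i : Fin p} (I : Inv T m G)
include I

theorem stepOK_of_localInv {pc : PC V} (h : LocalInv T (T.leaf i) m G pc) :
    StepOK T i m G (m, pc) :=
  ⟨G, I, (Mem.Le.refl m).ext G rfl, fun _ _ _ h => h, h⟩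

theorem stepOK_readBlock {v : Node} {b : ℤ} {k : Block V → PC V} (hb : m.Has v b)
    (h : LocalInv T (T.leaf i) m G (k (m.block v b))) : StepOK T i m G (readBlock m v b k) := by
  rw [readBlock_eq hb]
  exact stepOK_of_localInv I h

theorem stepOK_appendWrite (hp : 2 ≤ p) {op : Op V} {h : ℤ} {B : Block V}
    (H : LocalInv T (T.leaf i) m G (.appendWrite op h B)) :
    StepOK T i m G (exec T (T.leaf i) m (.appendWrite op h B)) := by
  obtain ⟨hc, hh, hs, h1, h2, h3⟩ := H
  have hl : T.IsLeaf (T.leaf i) := ⟨i, rfl⟩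
  obtain ⟨I', E⟩ := I.addBlock hh (by rw [hh]; exact hc) hs h1 h2 h3 (fun h => absurd hl h)
    (fun h => absurd hl h) (fun h => absurd h (leaf_ne_nil T hp i))
  refine ⟨G, I', E, ?_, ?_⟩
  · intro j hj k hk
    rcases Mem.has_setBlock.1 hk with ⟨h, _⟩ | h
    · exact absurd (T.leaf_not_suffix j i (by rw [h])) hj
    · exact h
  · refine localInv_callAdvance (Mem.has_setBlock.2 (Or.inl ⟨rfl, rfl⟩)) ⟨rfl, ?_, ?_⟩
    · rw [hh]
      exact I.head_pos _
    · intro k hk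
      have := I'.le_head hk
      rwa [hh]

theorem stepOK_refreshCas {op : Op V} {v : Node} {a : Attempt} {h : ℤ} {B : Block V}
    (H : LocalInv T (T.leaf i) m G (.refreshCas op v a h B)) :
    StepOK T i m G (exec T (T.leaf i) m (.refreshCas op v a h B)) := by
  obtain ⟨d, c, R, S, S', hne, hsize⟩ := H
  by_cases hb : m.Has v h
  · simp only [exec, hb.blocks_eq]
    exact stepOK_of_localInv I
      (localInv_callAdvance hb ⟨rfl, d, c, R.toRefreshInv, fun h => by cases h⟩)
  · simp only [exec, Mem.blocks_eq_none hb]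
    have hh : h = m.head v := by
      rcases R.h_le.eq_or_lt with h1 | h1
      · exact h1
      · exact absurd (I.filled (by have := R.one_le_h; omega) h1) hb
    have h1 := R.sumEnq_le I S
    have h2 := R.sumDeq_le I S'
    obtain ⟨I', E⟩ := I.addBlock hh hb R.super_eq h1 h2 (by omega)
      (fun _ dir => ⟨(R.ends dir).ghost_le, (R.ends dir).prev_le, (R.ends dir).lt_head⟩)
      (fun _ => ⟨S, S'⟩) hsize
    have N : ∀ j k, (m.setBlock v h B).Has (T.leaf j) k → m.Has (T.leaf j) k := by
      intro j k hk
      rcases Mem.has_setBlock.1 hk with ⟨h, _⟩ | h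
      · exact absurd ⟨j, h⟩ R.internal
      · exact h
    refine ⟨G, I', E, fun j _ => N j, ?_⟩
    refine localInv_callAdvance (Mem.has_setBlock.2 (Or.inl ⟨rfl, rfl⟩))
      ⟨rfl, d, c, R.toRefreshInv.mono I I' E (N i), fun _ => ?_⟩
    rw [Mem.block_setBlock_self]
    exact (R.ends d).target_le rfl

theorem stepOK_advSuper {op : Op V} {w : Node} {h hp : ℤ} {k : AdvanceCaller}
    (H : LocalInv T (T.leaf i) m G (.advSuper op w h hp k)) :
    StepOK T i m G (exec T (T.leaf i) m (.advSuper op w h hp k)) := by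
  obtain ⟨hw, C, d, u, rfl, h1, h2, M⟩ := H
  simp only [exec, hw.blocks_eq]
  split_ifs with hn
  · obtain ⟨I', E, N⟩ := I.setSuper hw hn h1 h2 M
    refine ⟨G, I', E, fun j _ k => (N _ k).1, E.has hw, ?_, fun _ => ?_⟩
    · exact C.mono I I' E (fun k => (N _ k).1) hw
    · rw [Mem.block_setBlock_self]
      rfl
  · exact stepOK_of_localInv I ⟨hw, C, fun _ => Option.isSome_iff_ne_none.2 hn⟩

theorem stepOK_advHead (hp : 2 ≤ p) {op : Op V} {w : Node} {h : ℤ} {k : AdvanceCaller}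
    (H : LocalInv T (T.leaf i) m G (.advHead op w h k)) :
    StepOK T i m G (exec T (T.leaf i) m (.advHead op w h k)) := by
  obtain ⟨hw, C, hs⟩ := H
  simp only [exec]
  split_ifs with hh
  · obtain ⟨G', I', E⟩ := I.setHead hh hw hs
    refine ⟨G', I', E, fun _ _ _ => id, ?_⟩
    refine localInv_returnAdvance I' hp hw ?_ (C.mono I I' E (fun _ => id) hw)
    simp [Mem.setHead]
  · refine stepOK_of_localInv I (localInv_returnAdvance I hp hw ?_ C)
    exact lt_of_le_of_ne (I.le_head hw) (Ne.symm hh)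

/-- The core of `IndexDequeue`: the index in `super` is that of the superblock or one less. -/
theorem stepOK_idTest {u : Node} {dir : Dir} {b k sup : ℤ}
    (H : LocalInv T (T.leaf i) m G (.idTest u dir b k sup)) :
    StepOK T i m G (exec T (T.leaf i) m (.idTest u dir b k sup)) := by
  obtain ⟨C, ⟨hb, -, s, hs, hus, hbs, hR⟩, hk, hsup⟩ := H
  have hu := C.internal
  have h1 := I.super_pos hb hsup
  have h2 := I.super_le hb hsup
  have h3 := I.endDir_super_lt hu hb hsup
  have h4 := I.super_marker hb hsup
  have hle : sup ≤ s := by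
    by_contra hn
    have := I.endDir_mono hu (I.nonneg hus) (by omega : s ≤ sup - 1)
      (I.filled (by omega) (by omega)) dir
    omega
  refine stepOK_readBlock I (I.has_of_le (by omega) hle hus) ?_
  split_ifs with hgt
  · have hne : sup ≠ s := by
      rintro rfl
      omega
    have hle' : sup + 1 ≤ s := by omega
    have h5 := I.ghost_le (d := dir) hu (by omega : 0 ≤ sup) (I.has_of_le (by omega) hle' hus)
    refine ⟨C, hR.of_le (by omega) hle', hk, ?_, (h4.2 (by omega)).trans h5⟩
    rw [add_sub_cancel_right]
    exact hgt
  · exact ⟨C, hR.of_le h1 hle, hk, h3, not_lt.1 hgt⟩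

theorem stepOK_frDouble {b e hi d : ℤ} (H : LocalInv T (T.leaf i) m G (.frDouble b e hi d)) :
    StepOK T i m G (exec T (T.leaf i) m (.frDouble b e hi d)) := by
  obtain ⟨hc, h1, h2, h3, h4, h5, h6, h7⟩ := H
  refine stepOK_readBlock I (I.filled (by omega) (by omega)) ?_
  split_ifs with hlt
  · exact localInv_frLoop hc ⟨by omega, h5, by omega, hlt, h7⟩
  · have hpos : 0 < b - d := by
      by_contra hn
      rw [max_eq_left (not_lt.1 hn), I.zero_sumEnq] at hlt
      omega
    exact ⟨hc, h1, h2, h3, by omega, by omega, by omega, not_lt.1 hlt⟩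

theorem stepOK_gePrevRight {v : Node} {b k sl pl j : ℤ}
    (H : LocalInv T (T.leaf i) m G (.gePrevRight v b k sl pl j)) :
    StepOK T i m G (exec T (T.leaf i) m (.gePrevRight v b k sl pl j)) := by
  obtain ⟨hc, Q, rfl, rfl, rfl⟩ := H
  have hv := Q.internal
  have h1 := I.sumEnq_eq hv (Q.has I)
  have h2 := I.sumEnq_eq hv (Q.has_prev I)
  have h3 := Q.rank_le
  have h4 := Q.rank_pos
  refine stepOK_readBlock I (I.has_endDir hv (Q.has_prev I) _) ?_
  split_ifs with hle
  · exact ⟨hc, Q.inTree, hv, Q.one_le, Q.lt_head, rfl, h4, by omega⟩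
  · exact ⟨hc, Q.inTree, hv, Q.one_le, Q.lt_head, rfl, by omega, by omega⟩

theorem stepOK_exec (hp : 2 ≤ p) {pc : PC V} (H : LocalInv T (T.leaf i) m G pc) :
    StepOK T i m G (exec T (T.leaf i) m pc) := by
  have hleaf : ∀ {h}, h = m.head (T.leaf i) → m.Has (T.leaf i) (h - 1) := by
    rintro h rfl
    have := I.head_pos (T.leaf i)
    exact I.filled (by omega) (by omega)
  cases pc
  case idle => exact stepOK_of_localInv I H
  case fault => exact H.elim
  case opHead => exact stepOK_of_localInv I ⟨H, rfl⟩
  case opSumEnq => exact stepOK_readBlock I (hleaf H.2) ⟨H.1, H.2, rfl⟩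
  case opSumDeq op h se =>
    obtain ⟨h1, h2, rfl⟩ := H
    refine stepOK_readBlock I (hleaf h2) ⟨h1, h2, ?_⟩
    cases op
    · exact ⟨rfl, by simp [opBlock], by simp [opBlock], by simp only [opBlock]; omega⟩
    · exact ⟨rfl, by simp [opBlock], by simp [opBlock], by simp only [opBlock]; omega⟩
  case appendWrite => exact stepOK_appendWrite I hp H
  case refreshHead op v a =>
    obtain ⟨d, c, P, M⟩ := H
    refine stepOK_of_localInv I ⟨d, c, ⟨P, I.head_pos v, le_rfl, ?_⟩, fun h => by cases h⟩
    cases a with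
    | first =>
      exact ⟨m.head v, I.head_pos v, le_rfl, fun h => (by cases h), marker_head
        (I.filled (by have := P.one_le; omega) P.lt_head)⟩
    | second =>
      obtain ⟨s, h0, h1, h2⟩ := M rfl
      exact ⟨s, h0, h1.le, fun _ => h1, h2⟩
  case refreshChildHead op v a h dir =>
    obtain ⟨d, c, R, H⟩ := H
    exact stepOK_of_localInv I ⟨d, c, R, H, I.le_head (I.ghost_has _ _ _), le_rfl⟩
  case refreshTest op v a h dir k =>
    obtain ⟨d, c, R, H, h1, h2⟩ := H
    simp only [exec]
    split_ifs with hk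
    · exact stepOK_of_localInv I (localInv_callAdvance hk ⟨rfl, d, c, R, H, h1⟩)
    · refine stepOK_of_localInv I (localInv_returnAdvance_help R H (lt_of_lt_of_le ?_ h2))
      exact lt_of_le_of_ne h1 fun h => hk (h ▸ I.ghost_has v dir _)
  case refreshCas => exact stepOK_refreshCas I H
  case advParentHead op w h k =>
    obtain ⟨hw, C, hne⟩ := H
    obtain ⟨d, u, rfl⟩ := List.exists_cons_of_ne_nil hne
    exact stepOK_of_localInv I ⟨hw, C, d, u, rfl, I.head_pos u, le_rfl, marker_head hw⟩
  case advSuper => exact stepOK_advSuper I H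
  case advHead => exact stepOK_advHead I hp H
  case cbEndLeft op v a h B =>
    obtain ⟨d, c, R, h1, h2⟩ := H
    have h3 := h1 .left
    have h4 := I.endDir_lt R.internal (R.has_prev I) .left
    refine stepOK_of_localInv I ⟨d, c, R, h1 .right, ⟨?_, ?_, ?_, ?_⟩, h2⟩
    · exact Int.le_sub_one_of_lt h3
    · exact Int.le_sub_one_of_lt h4
    · exact sub_one_lt _
    · rintro rfl
      exact Int.le_sub_one_of_lt R.lt_head
  case cbEndRight op v a h B =>
    obtain ⟨d, c, R, h1, ⟨e1, e2, e3, e4⟩, h2⟩ := H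
    have h4 := I.endDir_lt R.internal (R.has_prev I) .right
    refine stepOK_of_localInv I ⟨d, c, R, ?_, h2⟩
    rintro (_ | _)
    · exact ⟨e1, e2, e3, e4⟩
    · refine ⟨?_, ?_, ?_, ?_⟩
      · exact Int.le_sub_one_of_lt h1
      · exact Int.le_sub_one_of_lt h4
      · exact sub_one_lt _
      · rintro rfl
        exact Int.le_sub_one_of_lt R.lt_head
  case cbSumEnqLeft op v a h B =>
    obtain ⟨d, c, R⟩ := H
    exact stepOK_readBlock I (R.has_endLeft I)
      ⟨d, c, R.congr (by rintro (_ | _) <;> rfl) rfl, rfl⟩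
  case cbSumEnqRight op v a h B =>
    obtain ⟨d, c, R, h1⟩ := H
    refine stepOK_readBlock I (R.has_endRight I)
      ⟨d, c, R.congr (by rintro (_ | _) <;> rfl) rfl, ?_⟩
    rw [h1]
    exact rfl
  case cbSumDeqLeft op v a h B =>
    obtain ⟨d, c, R, h1⟩ := H
    exact stepOK_readBlock I (R.has_endLeft I)
      ⟨d, c, R.congr (by rintro (_ | _) <;> rfl) rfl, h1, rfl⟩
  case cbSumDeqRight op v a h B =>
    obtain ⟨d, c, R, h1, h2⟩ := H
    refine stepOK_readBlock I (R.has_endRight I)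
      ⟨d, c, R.congr (by rintro (_ | _) <;> rfl) rfl, h1, ?_⟩
    rw [h2]
    exact rfl
  case cbNumEnq op v a h B =>
    obtain ⟨d, c, R, h1, h2⟩ := H
    exact stepOK_readBlock I (R.has_prev I) ⟨d, c, R, h1, h2, rfl⟩
  case cbNumDeq op v a h B ne =>
    obtain ⟨d, c, R, h1, h2, h3⟩ := H
    refine stepOK_readBlock I (R.has_prev I) ?_
    split_ifs with hv
    · exact ⟨d, c, R, h1, h2, h3, rfl, hv⟩
    · exact localInv_returnCreateBlock I R h1 h2 h3 rfl fun h => absurd h hv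
  case cbSize op v a h B ne nd =>
    obtain ⟨d, c, R, h1, h2, h3, h4, rfl⟩ := H
    refine stepOK_readBlock I (R.has_prev I) ?_
    have R' : Candidate m G (T.leaf i) [] a h d c
        { B with size := max 0 ((m.block [] (h - 1)).size + ne - nd) } :=
      R.congr (by rintro (_ | _) <;> rfl) rfl
    refine localInv_returnCreateBlock I R' h1 h2 h3 h4 fun _ => ?_
    have e1 := I.size_le (R.has_prev I)
    have e2 := R.sumDeq_le I h2
    have e3 := R.sumEnq_le I h1
    have e4 := I.sumEnq_nonneg (R.has_prev I)
    change max 0 _ ≤ B.sumEnq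
    omega
  case deqLeafHead =>
    exact stepOK_of_localInv I (localInv_callIndexDequeue H.1 List.suffix_rfl H.2 le_rfl)
  case idSuper u dir b k =>
    obtain ⟨C, hR, hk⟩ := H
    refine stepOK_readBlock I (hR.has I) ?_
    obtain ⟨s, hs⟩ := Option.isSome_iff_exists.1
      (I.super_isSome (by have := hR.one_le; omega) hR.lt_head)
    rw [hs]
    exact ⟨C, hR, hk, hs⟩
  case idTest => exact stepOK_idTest I H
  case idPrevSum u dir b k sup =>
    obtain ⟨C, hR, hk, h1, h2⟩ := H
    have h3 := I.endDir_nonneg C.internal (hR.has_prev I) dir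
    have h4 := I.endDir_lt C.internal (hR.has I) dir
    have hb : m.Has (dir :: u) (b - 1) := I.filled (by omega) (by omega)
    refine stepOK_readBlock I hb ⟨C, hR, ?_⟩
    have := I.sumDeq_mono h3 (Int.le_sub_one_of_lt h1) hb
    omega
  case idStart u dir k sup =>
    obtain ⟨C, hR, h1⟩ := H
    exact stepOK_readBlock I (hR.has_prev I)
      ⟨C, hR, I.has_endDir C.internal (hR.has_prev I) dir, h1⟩
  case idStartSum u dir k sup j =>
    obtain ⟨C, hR, hj, h1⟩ := H
    refine stepOK_readBlock I hj ?_
    cases dir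
    · exact localInv_callIndexDequeue C.1 ((List.suffix_cons _ _).trans C.2) hR h1
    · exact ⟨C, hR, h1⟩
  case idLeftEnd u k sup =>
    obtain ⟨C, hR, h1⟩ := H
    exact stepOK_readBlock I (hR.has I) ⟨C, hR, h1, rfl⟩
  case idLeftEndSum u k sup j =>
    obtain ⟨C, hR, h1, rfl⟩ := H
    have hj := I.has_endDir C.internal (hR.has I) .left
    refine stepOK_readBlock I hj ⟨C, hR, ?_⟩
    have := I.sumDeq_mono (I.endDir_nonneg C.internal (hR.has_prev I) .left)
      (I.endDir_mono C.internal (by have := hR.one_le; omega) (by omega : sup - 1 ≤ sup)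
        (hR.has I) .left) hj
    omega
  case idLeftStart u k sup =>
    obtain ⟨C, hR, h1⟩ := H
    exact stepOK_readBlock I (hR.has_prev I)
      ⟨C, hR, I.has_endDir C.internal (hR.has_prev I) .left, h1⟩
  case idLeftStartSum u k sup j =>
    obtain ⟨C, hR, hj, h1⟩ := H
    exact stepOK_readBlock I hj
      (localInv_callIndexDequeue C.1 ((List.suffix_cons _ _).trans C.2) hR h1)
  case frSumEnq b k =>
    obtain ⟨hc, h1, h2, h3⟩ := H
    exact stepOK_readBlock I (I.filled (by omega) h2) ⟨hc, h1, h2, h3, rfl⟩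
  case frPrevSumEnq b k se =>
    obtain ⟨hc, h1, h2, h3, rfl⟩ := H
    exact stepOK_readBlock I (I.filled (by omega) (by omega))
      ⟨hc, h1, h2, h3, rfl, sub_add_cancel _ _⟩
  case frPrevSize b k ne pe =>
    obtain ⟨hc, h1, h2, h3, h4, h5⟩ := H
    have hb : m.Has [] (b - 1) := I.filled (by omega) (by omega)
    refine stepOK_readBlock I hb ?_
    have := I.size_le hb
    split_ifs with hlt
    · exact hc
    · exact ⟨hc, h1, h2, by omega, le_rfl, by omega, le_rfl, by omega⟩
  case frDouble => exact stepOK_frDouble I H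
  case frBinary e lo hi =>
    obtain ⟨hc, ⟨h1, h2, h3, h4, h5⟩, h6⟩ := H
    refine stepOK_readBlock I (I.filled (by omega) (by omega)) ?_
    split_ifs with hge
    · exact localInv_frLoop hc ⟨h1, by omega, by omega, h4, hge⟩
    · exact localInv_frLoop hc ⟨by omega, by omega, h3, not_le.1 hge, h5⟩
  case frRank e be =>
    obtain ⟨hc, S⟩ := H
    exact stepOK_readBlock I (I.filled S.nonneg (S.lt.trans S.lt_head))
      (localInv_callGetEnqueue I hc ⟨i, List.nil_suffix⟩ S)
  case geElement v b => exact stepOK_readBlock I H.2 H.1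
  case geEndLeft v b k => exact stepOK_readBlock I (H.2.has I) ⟨H.1, H.2, rfl⟩
  case geSumLeft v b k j =>
    obtain ⟨hc, Q, rfl⟩ := H
    exact stepOK_readBlock I (I.has_endDir Q.internal (Q.has I) _) ⟨hc, Q, rfl⟩
  case gePrevEndLeft v b k sl =>
    obtain ⟨hc, Q, h1⟩ := H
    exact stepOK_readBlock I (Q.has_prev I) ⟨hc, Q, h1, rfl⟩
  case gePrevLeft v b k sl j =>
    obtain ⟨hc, Q, h1, rfl⟩ := H
    exact stepOK_readBlock I (I.has_endDir Q.internal (Q.has_prev I) _) ⟨hc, Q, h1, rfl⟩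
  case gePrevEndRight v b k sl pl =>
    obtain ⟨hc, Q, h1, h2⟩ := H
    exact stepOK_readBlock I (Q.has_prev I) ⟨hc, Q, h1, h2, rfl⟩
  case gePrevRight => exact stepOK_gePrevRight I H
  case geLow v b k dir prev =>
    obtain ⟨hc, Q⟩ := H
    exact stepOK_readBlock I (Q.has_prev I) ⟨hc, Q, rfl⟩
  case geHigh v b k dir prev lo =>
    obtain ⟨hc, Q, rfl⟩ := H
    have h1 := I.has_endDir Q.internal (Q.has_prev I) dir
    have h2 := Q.rank_pos
    have h3 := Q.rank_le
    have h4 := Q.prev_eq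
    refine stepOK_readBlock I (Q.has I) (localInv_geLoop hc (Q.inTree.cons Q.internal dir) ?_)
    exact ⟨I.nonneg h1, I.lt_of_sumEnq_lt h1 (I.endDir_nonneg Q.internal (Q.has I) dir) (by omega),
      I.endDir_lt Q.internal (Q.has I) dir, by omega, h3⟩
  case geBinary w k prev lo hi =>
    obtain ⟨hc, hw, ⟨h1, h2, h3, h4, h5⟩, h6⟩ := H
    refine stepOK_readBlock I (I.filled (by omega) (by omega)) ?_
    split_ifs with hge
    · exact localInv_geLoop hc hw ⟨h1, by omega, by omega, h4, hge⟩
    · exact localInv_geLoop hc hw ⟨by omega, by omega, h3, not_le.1 hge, h5⟩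
  case geRank w k prev b' =>
    obtain ⟨hc, hw, S⟩ := H
    refine stepOK_readBlock I (I.filled S.nonneg (S.lt.trans S.lt_head)) ?_
    have := localInv_callGetEnqueue (G := G) I hc hw S
    rwa [← sub_sub_eq_add_sub] at this

end Step

/-! ### Termination -/

/-- The part of `stage` that belongs to the attempt of `Refresh`. -/
def attemptStage : Attempt → ℕ
  | .first => 50
  | .second => 0

/-- The part of `stage` that belongs to the iteration of the loop in `Refresh`. -/
def dirStage : Dir → ℕ
  | .left => 6
  | .right => 0

/-- The part of `stage` that belongs to the caller of `Advance`. -/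
def callerStage (D : ℕ) : AdvanceCaller → ℕ
  | .append => 100 * (D + 1)
  | .help v a _ dir => 100 * v.length + attemptStage a + 27 + dirStage dir
  | .final v a _ => 100 * v.length + attemptStage a + 13

/-- The largest value of `stage` in `FindResponse` and `GetEnqueue`. -/
def searchStage (D : ℕ) : ℕ := 20 * (D + 1) + 5

/-- The value of `stage` when a `Dequeue` has appended its block. -/
def indexStage (D : ℕ) : ℕ := searchStage D + 20 * (D + 1)

/-- A bound on the number of stages of the operation that are still ahead, where every search loop
counts as one stage and `D` is a bound on the depth of the leaves. The constants number the local
states of a routine backwards: 20 for each level of `IndexDequeue` or `GetEnqueue`, 100 for each level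
of `Propagate`, of which 50 are for the first attempt of `Refresh`. -/
def stage (D : ℕ) : PC V → ℕ
  | .idle _ => 0
  | .fault => 0
  | .geElement v _ => 20 * (D - v.length)
  | .geEndLeft v _ _ => 20 * (D - v.length) + 15
  | .geSumLeft v _ _ _ => 20 * (D - v.length) + 14
  | .gePrevEndLeft v _ _ _ => 20 * (D - v.length) + 13
  | .gePrevLeft v _ _ _ _ => 20 * (D - v.length) + 12
  | .gePrevEndRight v _ _ _ _ => 20 * (D - v.length) + 11
  | .gePrevRight v _ _ _ _ _ => 20 * (D - v.length) + 10
  | .geLow v _ _ _ _ => 20 * (D - v.length) + 9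
  | .geHigh v _ _ _ _ _ => 20 * (D - v.length) + 8
  | .geBinary w _ _ _ _ => 20 * (D - w.length) + 17
  | .geRank w _ _ _ => 20 * (D - w.length) + 16
  | .frRank _ _ => 20 * (D + 1)
  | .frBinary _ _ _ => 20 * (D + 1) + 1
  | .frDouble _ _ _ _ => 20 * (D + 1) + 2
  | .frPrevSize _ _ _ _ => 20 * (D + 1) + 3
  | .frPrevSumEnq _ _ _ => 20 * (D + 1) + 4
  | .frSumEnq _ _ => searchStage D
  | .idLeftStartSum u _ _ _ => searchStage D + 20 * u.length + 1
  | .idLeftStart u _ _ => searchStage D + 20 * u.length + 2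
  | .idLeftEndSum u _ _ _ => searchStage D + 20 * u.length + 3
  | .idLeftEnd u _ _ => searchStage D + 20 * u.length + 4
  | .idStartSum u _ _ _ _ => searchStage D + 20 * u.length + 5
  | .idStart u _ _ _ => searchStage D + 20 * u.length + 6
  | .idPrevSum u _ _ _ _ => searchStage D + 20 * u.length + 7
  | .idTest u _ _ _ _ => searchStage D + 20 * u.length + 8
  | .idSuper u _ _ _ => searchStage D + 20 * u.length + 9
  | .deqLeafHead => indexStage D
  | .refreshHead _ v a => indexStage D + 100 * v.length + attemptStage a + 40
  | .refreshChildHead _ v a _ dir =>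
    indexStage D + 100 * v.length + attemptStage a + 32 + dirStage dir
  | .refreshTest _ v a _ dir _ =>
    indexStage D + 100 * v.length + attemptStage a + 31 + dirStage dir
  | .cbEndLeft _ v a _ _ => indexStage D + 100 * v.length + attemptStage a + 26
  | .cbEndRight _ v a _ _ => indexStage D + 100 * v.length + attemptStage a + 25
  | .cbSumEnqLeft _ v a _ _ => indexStage D + 100 * v.length + attemptStage a + 24
  | .cbSumEnqRight _ v a _ _ => indexStage D + 100 * v.length + attemptStage a + 23
  | .cbSumDeqLeft _ v a _ _ => indexStage D + 100 * v.length + attemptStage a + 22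
  | .cbSumDeqRight _ v a _ _ => indexStage D + 100 * v.length + attemptStage a + 21
  | .cbNumEnq _ v a _ _ => indexStage D + 100 * v.length + attemptStage a + 20
  | .cbNumDeq _ v a _ _ _ => indexStage D + 100 * v.length + attemptStage a + 19
  | .cbSize _ v a _ _ _ _ => indexStage D + 100 * v.length + attemptStage a + 18
  | .refreshCas _ v a _ _ => indexStage D + 100 * v.length + attemptStage a + 17
  | .advParentHead _ _ _ c => indexStage D + callerStage D c + 3
  | .advSuper _ _ _ _ c => indexStage D + callerStage D c + 2
  | .advHead _ _ _ c => indexStage D + callerStage D c + 1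
  | .appendWrite _ _ _ => indexStage D + 100 * (D + 1) + 4
  | .opSumDeq _ _ _ => indexStage D + 100 * (D + 1) + 5
  | .opSumEnq _ _ => indexStage D + 100 * (D + 1) + 6
  | .opHead _ => indexStage D + 100 * (D + 1) + 7

/-- In the search loops, a bound on the number of iterations ahead. -/
def counter : PC V → ℕ
  | .frDouble b _ _ d => (b - d).toNat
  | .frBinary _ lo hi => (hi - lo).toNat
  | .geBinary _ _ _ lo hi => (hi - lo).toNat
  | _ => 0

/-- The order in which the local state of a process decreases: lexicographic in `stage` and
`counter`. -/
def Below (D : ℕ) (pc' pc : PC V) : Prop :=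
  Prod.Lex (· < ·) (· < ·) (stage D pc', counter pc') (stage D pc, counter pc)

theorem wellFounded_below (D : ℕ) : WellFounded (Below (V := V) D) :=
  InvImage.wf (fun pc : PC V => (stage D pc, counter pc))
    (WellFounded.prod_lex wellFounded_lt wellFounded_lt)

theorem below_of_stage_lt {D : ℕ} {pc' pc : PC V} (h : stage D pc' < stage D pc) :
    Below D pc' pc := Prod.Lex.left _ _ h

theorem below_of_counter_lt {D : ℕ} {pc' pc : PC V} (h : stage D pc' = stage D pc)
    (h' : counter pc' < counter pc) : Below D pc' pc := by
  unfold Below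
  rw [h]
  exact Prod.Lex.right _ h'

section Stages

variable {D : ℕ}

theorem stage_callAdvance (op : Op V) (v : Node) (h : ℤ) (c : AdvanceCaller) :
    stage D (callAdvance op v h c) ≤ indexStage D + callerStage D c + 3 := by
  unfold callAdvance
  split_ifs <;> simp only [stage] <;> omega

theorem stage_returnRefresh (op : Op V) (v : Node) (a : Attempt) (r : Bool) :
    stage D (returnRefresh op v a r) < indexStage D + 100 * v.length + attemptStage a + 14 := by
  unfold returnRefresh
  split_ifs with h
  · rw [h.2]
    simp only [stage, attemptStage]
    omega
  · cases v with
    | nil =>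
      cases op <;> simp only [returnAppend, stage] <;> omega
    | cons d u =>
      simp only [stage, attemptStage, List.length_cons]
      omega

theorem stage_returnAdvance (op : Op V) {ℓ : Node} (hℓ : ℓ.length ≤ D) (c : AdvanceCaller) :
    stage D (returnAdvance op ℓ c) < indexStage D + callerStage D c + 1 := by
  rcases c with _ | ⟨v, a, h, _ | _⟩ | ⟨v, a, r⟩
  · simp only [returnAdvance, stage, callerStage, attemptStage, List.length_tail]
    omega
  · simp only [returnAdvance, stage, callerStage, dirStage]
    omega
  · simp only [returnAdvance, stage, callerStage, dirStage]
    omega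
  · have := stage_returnRefresh (D := D) op v a r
    simp only [returnAdvance, callerStage]
    omega

theorem stage_returnCreateBlock (op : Op V) (v : Node) (a : Attempt) (i : ℤ) (B : Block V)
    (ne nd : ℤ) : stage D (returnCreateBlock op v a i B ne nd) <
      indexStage D + 100 * v.length + attemptStage a + 18 := by
  unfold returnCreateBlock
  have := stage_returnRefresh (D := D) op v a true
  split_ifs
  · omega
  · simp only [stage]
    omega

theorem stage_callIndexDequeue (v : Node) (b i : ℤ) :
    stage D (callIndexDequeue v b i : PC V) ≤ searchStage D + 20 * v.length := by
  cases v with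
  | nil => simp [callIndexDequeue, stage]
  | cons d u =>
    simp only [callIndexDequeue, stage, List.length_cons]
    omega

theorem stage_callGetEnqueue (T : OrderingTree p) (v : Node) (b i : ℤ) :
    stage D (callGetEnqueue T v b i : PC V) ≤ 20 * (D - v.length) + 15 := by
  unfold callGetEnqueue
  split_ifs <;> simp only [stage] <;> omega

theorem stage_frLoop (e lo hi : ℤ) : stage D (frLoop e lo hi : PC V) ≤ 20 * (D + 1) + 1 := by
  unfold frLoop
  split_ifs <;> simp only [stage] <;> omega

theorem stage_geLoop (w : Node) (i prev lo hi : ℤ) :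
    stage D (geLoop w i prev lo hi : PC V) ≤ 20 * (D - w.length) + 17 := by
  unfold geLoop
  split_ifs <;> simp only [stage] <;> omega

theorem frLoop_below {e lo hi lo' hi' : ℤ} (h : lo < hi) (h' : hi' - lo' < hi - lo) :
    Below D (frLoop e lo' hi' : PC V) (.frBinary e lo hi) := by
  unfold frLoop
  split_ifs
  · exact below_of_counter_lt rfl (by simp only [counter]; omega)
  · exact below_of_stage_lt (by simp only [stage]; omega)

theorem geLoop_below {w : Node} {i prev lo hi lo' hi' : ℤ} (h : lo < hi)
    (h' : hi' - lo' < hi - lo) :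
    Below D (geLoop w i prev lo' hi' : PC V) (.geBinary w i prev lo hi) := by
  unfold geLoop
  split_ifs
  · exact below_of_counter_lt rfl (by simp only [counter]; omega)
  · exact below_of_stage_lt (by simp only [stage]; omega)

end Stages

theorem InTree.length_le {T : OrderingTree p} {w : Node} (h : InTree T w) :
    w.length ≤ Nat.clog 2 p := by
  obtain ⟨j, hj⟩ := h
  exact hj.length_le.trans (T.height_le j)

section Decrease

variable {T : OrderingTree p} {m : Mem V} {G : Ghost} {i : Fin p} (I : Inv T m G)

theorem readBlock_below {D : ℕ} {v : Node} {b : ℤ} {k : Block V → PC V} {pc : PC V}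
    (hpc : 0 < stage D pc) (h : Below D (k (m.block v b)) pc) :
    Below D (readBlock m v b k).2 pc := by
  by_cases hb : m.Has v b
  · rwa [readBlock_eq hb]
  · simp only [readBlock, Mem.blocks_eq_none hb]
    exact below_of_stage_lt hpc

include I in
/-- Every step inside an operation makes the local state smaller or ends the operation. -/
theorem exec_below {pc : PC V} (H : LocalInv T (T.leaf i) m G pc) (hpc : ¬ pc.IsIdle) :
    (exec T (T.leaf i) m pc).2.IsIdle ∨ Below (Nat.clog 2 p) (exec T (T.leaf i) m pc).2 pc := by
  set D := Nat.clog 2 p with hD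
  have hℓ : (T.leaf i).length ≤ D := T.height_le i
  cases pc
  case idle => exact absurd trivial hpc
  case fault => exact H.elim
  case opHead => exact Or.inr (below_of_stage_lt (by simp only [exec, stage]; omega))
  case opSumEnq =>
    exact Or.inr (readBlock_below (by simp only [stage]; omega)
      (below_of_stage_lt (by simp only [stage]; omega)))
  case opSumDeq =>
    exact Or.inr (readBlock_below (by simp only [stage]; omega)
      (below_of_stage_lt (by simp only [stage]; omega)))
  case appendWrite op h B =>
    have := stage_callAdvance (D := D) op (T.leaf i) h .append
    exact Or.inr (below_of_stage_lt (by simp only [exec, stage, callerStage] at *; omega))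
  case refreshHead op v a =>
    exact Or.inr (below_of_stage_lt (by simp only [exec, stage, dirStage]; omega))
  case refreshChildHead => exact Or.inr (below_of_stage_lt (by simp only [exec, stage]; omega))
  case refreshTest op v a h dir k =>
    refine Or.inr (below_of_stage_lt ?_)
    simp only [exec]
    split_ifs
    · have := stage_callAdvance (D := D) op (dir :: v) k (.help v a h dir)
      simp only [stage, callerStage] at *
      omega
    · have := stage_returnAdvance (D := D) op hℓ (.help v a h dir)
      simp only [stage, callerStage] at *
      omega
  case refreshCas op v a h B =>
    refine Or.inr (below_of_stage_lt ?_)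
    have h1 := stage_callAdvance (D := D) op v h (.final v a true)
    have h2 := stage_callAdvance (D := D) op v h (.final v a false)
    simp only [exec]
    split <;> simp only [stage, callerStage] at * <;> omega
  case advParentHead => exact Or.inr (below_of_stage_lt (by simp only [exec, stage]; omega))
  case advSuper =>
    refine Or.inr (below_of_stage_lt ?_)
    simp only [exec]
    split <;> simp only [stage] <;> omega
  case advHead op w h k => exact Or.inr (below_of_stage_lt (stage_returnAdvance op hℓ k))
  case cbEndLeft => exact Or.inr (below_of_stage_lt (by simp only [exec, stage]; omega))
  case cbEndRight => exact Or.inr (below_of_stage_lt (by simp only [exec, stage]; omega))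
  case cbNumDeq op v a h B ne =>
    refine Or.inr (readBlock_below (by simp only [stage]; omega) (below_of_stage_lt ?_))
    split_ifs
    · simp only [stage]
      omega
    · exact (stage_returnCreateBlock op v a h B ne _).trans (by simp only [stage]; omega)
  case cbSize op v a h B ne nd =>
    exact Or.inr (readBlock_below (by simp only [stage]; omega)
      (below_of_stage_lt (stage_returnCreateBlock op v a h _ ne nd)))
  case deqLeafHead =>
    refine Or.inr (below_of_stage_lt ((stage_callIndexDequeue _ _ _).trans_lt ?_))
    simp only [stage, indexStage]
    omega
  case idSuper =>
    refine Or.inr (readBlock_below (by simp only [stage]; omega) (below_of_stage_lt ?_))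
    split <;> simp only [stage] <;> omega
  case idStartSum u dir k sup j =>
    refine Or.inr (readBlock_below (by simp only [stage]; omega) (below_of_stage_lt ?_))
    cases dir
    · exact (stage_callIndexDequeue _ _ _).trans_lt (by simp only [stage]; omega)
    · simp only [stage]
      omega
  case idLeftStartSum u k sup j =>
    exact Or.inr (readBlock_below (by simp only [stage]; omega) (below_of_stage_lt
      ((stage_callIndexDequeue _ _ _).trans_lt (by simp only [stage]; omega))))
  case frSumEnq =>
    exact Or.inr (readBlock_below (by simp only [stage, searchStage]; omega)
      (below_of_stage_lt (by simp only [stage, searchStage]; omega)))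
  case frPrevSize b k ne pe =>
    obtain ⟨-, h1, h2, -⟩ := H
    simp only [exec]
    rw [readBlock_eq (I.filled (by omega) (by omega))]
    split_ifs
    · exact Or.inl trivial
    · exact Or.inr (below_of_stage_lt (by simp only [stage]; omega))
  case frDouble b e hi d =>
    obtain ⟨-, h1, h2, h3, h4, -⟩ := H
    refine Or.inr (readBlock_below (by simp only [stage]; omega) ?_)
    split_ifs with hlt
    · exact below_of_stage_lt ((stage_frLoop _ _ _).trans_lt (by simp only [stage]; omega))
    · have hpos : 0 < b - d := by
        by_contra hn
        rw [max_eq_left (not_lt.1 hn), I.zero_sumEnq] at hlt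
        omega
      exact below_of_counter_lt rfl (by simp only [counter]; omega)
  case frBinary e lo hi =>
    obtain ⟨-, S, hlo⟩ := H
    refine Or.inr (readBlock_below (by simp only [stage]; omega) ?_)
    split_ifs
    · exact frLoop_below S.lt (by omega)
    · exact frLoop_below S.lt (by omega)
  case frRank =>
    exact Or.inr (readBlock_below (by simp only [stage]; omega) (below_of_stage_lt
      ((stage_callGetEnqueue _ _ _ _).trans_lt (by simp only [stage]; omega))))
  case geElement v b =>
    refine Or.inl ?_
    simp only [exec]
    rw [readBlock_eq H.2]
    trivial
  case gePrevRight =>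
    refine Or.inr (readBlock_below (by simp only [stage]; omega) (below_of_stage_lt ?_))
    split_ifs <;> simp only [stage] <;> omega
  case geHigh v b k dir prev lo =>
    obtain ⟨-, Q, -⟩ := H
    have := (Q.inTree.cons Q.internal dir).length_le
    refine Or.inr (readBlock_below (by simp only [stage]; omega) (below_of_stage_lt
      ((stage_geLoop _ _ _ _ _).trans_lt ?_)))
    simp only [stage, List.length_cons] at *
    omega
  case geBinary w k prev lo hi =>
    obtain ⟨-, -, S, hlo⟩ := H
    refine Or.inr (readBlock_below (by simp only [stage]; omega) ?_)
    split_ifs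
    · exact geLoop_below S.lt (by omega)
    · exact geLoop_below S.lt (by omega)
  case geRank =>
    exact Or.inr (readBlock_below (by simp only [stage]; omega) (below_of_stage_lt
      ((stage_callGetEnqueue _ _ _ _).trans_lt (by simp only [stage]; omega))))
  all_goals
    exact Or.inr (readBlock_below (by simp only [stage]; omega)
      (below_of_stage_lt (by simp only [stage]; omega)))

end Decrease

/-! ### Executions -/

/-- The invariant of a configuration. -/
def ConfigInv (T : OrderingTree p) (C : Config V p) : Prop :=
  ∃ G, Inv T C.mem G ∧ ∀ j, LocalInv T (T.leaf j) C.mem G (C.pc j)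

theorem configInv_initial (T : OrderingTree p) : ConfigInv T (Config.initial V p) := by
  refine ⟨_, inv_initial T, fun j => ?_⟩
  change ¬ (Mem.initial V).Has (T.leaf j) 1
  simp [Mem.Has, Mem.initial]

theorem ConfigInv.step {T : OrderingTree p} (hp : 2 ≤ p) {i : Fin p} {C C' : Config V p}
    (h : ConfigInv T C) (s : Step T i C C') : ConfigInv T C' := by
  obtain ⟨G, I, H⟩ := h
  cases s with
  | invoke op hidle =>
    refine ⟨G, I, fun j => ?_⟩
    by_cases hj : j = i
    · subst hj
      have hj := H j
      revert hj hidle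
      cases C.pc j <;> simp [PC.IsIdle, LocalInv]
    · simpa [hj] using H j
  | advance hidle =>
    obtain ⟨G', I', E, N, hL⟩ := stepOK_exec I hp (H i)
    refine ⟨G', I', fun j => ?_⟩
    by_cases hj : j = i
    · subst hj
      simpa using hL
    · simpa [hj] using (H j).mono I I' E (N j hj)

theorem Step.pc_of_ne {T : OrderingTree p} {i j : Fin p} {C C' : Config V p} (s : Step T i C C')
    (h : j ≠ i) : C'.pc j = C.pc j := by
  cases s <;> simp [h]

theorem Step.pc_self {T : OrderingTree p} {i : Fin p} {C C' : Config V p} (s : Step T i C C')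
    (h : ¬ (C.pc i).IsIdle) : C'.pc i = (exec T (T.leaf i) C.mem (C.pc i)).2 := by
  cases s with
  | invoke op h' => exact absurd h' h
  | advance _ => simp

theorem Execution.configInv {T : OrderingTree p} (hp : 2 ≤ p) (E : Execution V T) (t : ℕ) :
    ConfigInv T (E.config t) := by
  induction t with
  | zero => rw [E.start]; exact configInv_initial T
  | succ t ih => exact ih.step hp (E.step t)

/-- A process that is scheduled again takes its next step from its present local state. -/
theorem Execution.exists_next {T : OrderingTree p} (E : Execution V T) {i : Fin p}
    (hs : ∀ n, ∃ k ≥ n, E.sched k = i) (t : ℕ) :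
    ∃ k ≥ t, E.sched k = i ∧ (E.config k).pc i = (E.config t).pc i := by
  classical
  obtain ⟨hk, hi⟩ := Nat.find_spec (hs t)
  have hmin : ∀ k, t ≤ k → k < Nat.find (hs t) → E.sched k ≠ i :=
    fun k h1 h2 h3 => Nat.find_min (hs t) h2 ⟨h1, h3⟩
  have hpc : ∀ k, t ≤ k → k ≤ Nat.find (hs t) → (E.config k).pc i = (E.config t).pc i := by
    intro k h1
    induction k, h1 using Nat.le_induction with
    | base => exact fun _ => rfl
    | succ k h1 ih =>
      intro h2
      exact ((E.step k).pc_of_ne (hmin k h1 (by omega)).symm).trans (ih (by omega))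
  exact ⟨_, hk, hi, hpc _ hk le_rfl⟩

end WFQueue

theorem mainTheorem3 {V : Type*} {p : ℕ} (hp : 2 ≤ p) (T : WFQueue.OrderingTree p) :
    WFQueue.WaitFree V T := by
  intro E i t ht hs
  generalize hpc : (E.config t).pc i = pc
  induction pc using (WFQueue.wellFounded_below (V := V) (Nat.clog 2 p)).induction
    generalizing t with
  | _ pc ih =>
    subst hpc
    obtain ⟨k, hk, hi, hpc⟩ := E.exists_next hs t
    obtain ⟨G, I, H⟩ := E.configInv hp k
    have hidle : ¬ ((E.config k).pc i).IsIdle := by rwa [hpc]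
    have hstep : (E.config (k + 1)).pc i = _ := (hi ▸ E.step k).pc_self hidle
    by_cases hd : ((E.config (k + 1)).pc i).IsIdle
    · exact ⟨k + 1, by omega, hd⟩
    · rcases WFQueue.exec_below I (H i) hidle with h | h
      · rw [← hstep] at h
        exact absurd h hd
      · rw [← hstep, hpc] at h
        obtain ⟨t', ht', h'⟩ := ih _ h (k + 1) hd rfl
        exact ⟨t', by omega, h'⟩
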